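/- Let $d\ge 2$, let $\mathcal H_1,\dots,\mathcal H_d$ be separable real Hilbert spaces and let $\mathcal H=\mathcal H_1\otimes\cdots\otimes\mathcal H_d$ be their Hilbert space tensor product. Let $\mathbb T$ be a binary dimension tree with root $\{1,\dots,d\}$ (a finite set of nodes, each a subset of $\{1,\dots,d\}$; the leaves are singletons and every other node is the disjoint union of its two sons), put $[n]=\{1,\dots,d\}\setminus n$, and let $\{n_t,[n_t]\}$, $t=1,\dots,E$, be an enumeration without repetition of the set of edges $\{\{n,[n]\}: n\in\mathbb T,\ n\neq\{1,\dots,d\}\}$. For $u\in\mathcal H$ let $\mathcal M_t(u):\bigotimes_{i\in[n_t]}\mathcal H_i\to\bigotimes_{i\in n_t}\mathcal H_i$ be the matricization of $u$ along the $t$-th edge, that is, the Hilbert–Schmidt operator with $\langle x,\mathcal M_t(u)y\rangle=\langle x\otimes y,u\rangle$. Let $\sigma_t(u)=(\sigma_{t,k}(u))_{k\ge1}$ be the nonincreasing sequence of its singular values, extended by zero if $\mathcal M_t(u)$ has finite rank, and put $\operatorname{rank}_t(u)=\operatorname{rank}\mathcal M_t(u)$. For $\alpha>0$ let $s_\alpha(x)=\operatorname{sgn}(x)\max\{|x|-\alpha,0\}$.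 For a Hilbert–Schmidt operator $X=\sum_k\sigma_k\langle g_k,\cdot\rangle f_k$ (singular value decomposition) let $S_\alpha(X)=\sum_k s_\alpha(\sigma_k)\langle g_k,\cdot\rangle f_k$. Put $S_{t,\alpha}=\mathcal M_t^{-1}\circ S_\alpha\circ\mathcal M_t$ and $\mathbf S_\alpha=S_{E,\alpha}\circ\cdots\circ S_{1,\alpha}$. Let $u\in\mathcal H$. Then for every $t$ the sequence $\sigma_t(u)$ is square summable, and for every $r\in\mathbb N_0$ $$\tau_{t,r}(u):=\inf_{\operatorname{rank}_t(w)\le r}\|u-w\|=\Bigl(\sum_{k>r}\sigma_{t,k}(u)^2\Bigr)^{1/2}.$$ For every $t$ and $\delta>0$ the maximum $r_{t,\delta}(u):=\max\bigl(\{r\ge1:\sigma_{t,r}(u)>\delta\}\cup\{0\}\bigr)$ exists. Moreover, for every $\alpha>0$, $$\max_{t=1,\dots,E}d_t^\alpha(u)\le\|\mathbf S_\alpha(u)-u\|\le\sum_{t=1}^E d_t^\alpha(u),$$ where, with $\tau_{t,\alpha}(u):=\tau_{t,r_{t,\alpha}(u)}(u)$, $$d_t^\alpha(u):=\bigl\|\sigma_t(S_{t,\alpha}(u))-\sigma_t(u)\bigr\|_{\ell_2}=\sqrt{\alpha^2\,r_{t,\alpha}(u)+\tau_{t,\alpha}(u)^2}.$$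 -/

import Mathlib

noncomputable section

namespace HTensor

open scoped TensorProduct InnerProductSpace

/-! ### The Hilbert space tensor product of a finite family of real Hilbert spaces -/

section HilbertTensorProduct

variable {ι : Type*} [Fintype ι] (H : ι → Type*)
  [∀ i, NormedAddCommGroup (H i)] [∀ i, InnerProductSpace ℝ (H i)]

/-- The algebraic tensor product of the spaces `H i`; a type synonym, since Mathlib equips
`⨂[ℝ] i, H i` with the projective seminorm, which is not the one needed here. -/
def AlgTensor : Type _ := ⨂[ℝ] i, H i

instance : AddCommGroup (AlgTensor H) := inferInstanceAs (AddCommGroup (⨂[ℝ] i, H i))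

instance : Module ℝ (AlgTensor H) := inferInstanceAs (Module ℝ (⨂[ℝ] i, H i))

variable {H} in
/-- The elementary tensor of the vectors `x i`. -/
def algPure (x : ∀ i, H i) : AlgTensor H := PiTensorProduct.tprod ℝ x

/-- The bilinear form on the algebraic tensor product which on elementary tensors is the product
of the inner products of the factors. -/
def tensorForm : AlgTensor H →ₗ[ℝ] AlgTensor H →ₗ[ℝ] ℝ :=
  (PiTensorProduct.dualDistrib (R := ℝ) (M := H)) ∘ₗ
    (PiTensorProduct.map (fun i => innerₗ (H i)))

variable {H}

theorem tensorForm_algPure (x y : ∀ i, H i) :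
    tensorForm H (algPure x) (algPure y) = ∏ i, ⟪x i, y i⟫_ℝ := by
  change PiTensorProduct.dualDistrib (R := ℝ) (M := H)
    (PiTensorProduct.map (fun i => innerₗ (H i)) (PiTensorProduct.tprod ℝ x))
    (PiTensorProduct.tprod ℝ y) = _
  rw [PiTensorProduct.map_tprod]
  exact PiTensorProduct.dualDistrib_apply _ _

theorem algTensor_induction {P : AlgTensor H → Prop} (u : AlgTensor H)
    (smul : ∀ (c : ℝ) (x : ∀ i, H i), P (c • algPure x))
    (add : ∀ u v, P u → P v → P (u + v)) : P u :=
  PiTensorProduct.induction_on (R := ℝ) (s := H) (motive := P) u smul add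

theorem tensorForm_symm (u v : AlgTensor H) : tensorForm H u v = tensorForm H v u := by
  induction u using algTensor_induction with
  | smul c x =>
    induction v using algTensor_induction with
    | smul c' y =>
      simp only [map_smul, LinearMap.smul_apply, tensorForm_algPure, smul_eq_mul,
        real_inner_comm]
      ring
    | add v w hv hw => simp only [map_add, LinearMap.add_apply, hv, hw]
  | add u w hu hw => simp only [map_add, LinearMap.add_apply, hu, hw]

theorem algTensor_exists_sum (u : AlgTensor H) :
    ∃ (m : ℕ) (c : Fin m → ℝ) (x : Fin m → ∀ i, H i), u = ∑ a, c a • algPure (x a) := by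
  induction u using algTensor_induction with
  | smul c x => exact ⟨1, fun _ => c, fun _ => x, by simp⟩
  | add u v hu hv =>
    obtain ⟨m, c, x, rfl⟩ := hu
    obtain ⟨m', c', x', rfl⟩ := hv
    exact ⟨m + m', Fin.append c c', Fin.append x x', by simp [Fin.sum_univ_add]⟩

open scoped Matrix in
theorem posSemidef_prod_inner {m : ℕ} (x : Fin m → ∀ i, H i) (s : Finset ι) :
    (Matrix.of fun a b => ∏ i ∈ s, ⟪x a i, x b i⟫_ℝ).PosSemidef := by
  classical
  induction s using Finset.induction_on with
  | empty =>
    have h := Matrix.posSemidef_vecMulVec_self_star (fun _ : Fin m => (1 : ℝ))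
    have e : (Matrix.of fun a b => ∏ i ∈ (∅ : Finset ι), ⟪x a i, x b i⟫_ℝ)
        = Matrix.vecMulVec (fun _ : Fin m => (1 : ℝ)) (star fun _ => 1) := by
      ext a b
      simp [Matrix.vecMulVec_apply]
    rw [e]
    exact h
  | insert i s hi ih =>
    have h := (Matrix.posSemidef_gram ℝ (fun a => x a i)).hadamard ih
    have e : (Matrix.of fun a b => ∏ j ∈ insert i s, ⟪x a j, x b j⟫_ℝ)
        = (Matrix.gram ℝ (fun a => x a i)) ⊙
          (Matrix.of fun a b => ∏ j ∈ s, ⟪x a j, x b j⟫_ℝ) := by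
      ext a b
      simp [Finset.prod_insert hi, Matrix.gram_apply]
    rw [e]
    exact h

theorem tensorForm_self_nonneg (u : AlgTensor H) : 0 ≤ tensorForm H u u := by
  obtain ⟨m, c, x, rfl⟩ := algTensor_exists_sum u
  have h := (posSemidef_prod_inner x Finset.univ).dotProduct_mulVec_nonneg c
  refine h.trans_eq ?_
  simp only [dotProduct, Matrix.mulVec, Matrix.of_apply, Pi.star_apply, star_trivial, map_sum,
    LinearMap.sum_apply, map_smul, LinearMap.smul_apply, tensorForm_algPure, smul_eq_mul,
    Finset.mul_sum]
  rw [Finset.sum_comm]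
  refine Finset.sum_congr rfl fun a _ => Finset.sum_congr rfl fun b _ => ?_
  ring_nf

variable (H)

/-- The (semi)definite inner product on the algebraic tensor product. -/
@[reducible]
def algTensorCore : PreInnerProductSpace.Core ℝ (AlgTensor H) where
  inner u v := tensorForm H u v
  conj_inner_symm u v := tensorForm_symm v u
  re_inner_nonneg u := tensorForm_self_nonneg u
  add_left u v w := by simp
  smul_left u v c := by simp

instance : SeminormedAddCommGroup (AlgTensor H) :=
  InnerProductSpace.Core.toSeminormedAddCommGroup (c := algTensorCore H)

instance : InnerProductSpace ℝ (AlgTensor H) := InnerProductSpace.ofCore (algTensorCore H)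

/-- The Hilbert space tensor product of the `H i`: the completion of the algebraic tensor product
for the inner product with `⟪⨂ x i, ⨂ y i⟫ = ∏ ⟪x i, y i⟫`. -/
abbrev HilbertTensor : Type _ := UniformSpace.Completion (AlgTensor H)

variable {H}

theorem inner_algPure (x y : ∀ i, H i) :
    ⟪algPure x, algPure y⟫_ℝ = ∏ i, ⟪x i, y i⟫_ℝ := tensorForm_algPure x y

end HilbertTensorProduct

/-! ### Matricizations -/

section Bilinear

variable {E F G : Type*} [NormedAddCommGroup E] [InnerProductSpace ℝ E]
  [NormedAddCommGroup F] [InnerProductSpace ℝ F] [CompleteSpace F]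
  [NormedAddCommGroup G] [InnerProductSpace ℝ G] [CompleteSpace G]

/-- The operator `M` determined by `⟪x, M y⟫ = ⟪B x y, u⟫`. -/
def operatorOfBilin (B : F →L[ℝ] E →L[ℝ] G) (u : G) : E →L[ℝ] F :=
  LinearMap.mkContinuous
    { toFun := fun y => ContinuousLinearMap.adjoint (B.flip y) u
      map_add' := fun y z => by simp
      map_smul' := fun c y => by simp }
    (‖B.flip‖ * ‖u‖)
    (fun y => by
      refine (ContinuousLinearMap.le_opNorm (ContinuousLinearMap.adjoint (B.flip y)) u).trans ?_
      rw [LinearIsometryEquiv.norm_map]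
      calc ‖B.flip y‖ * ‖u‖ ≤ (‖B.flip‖ * ‖y‖) * ‖u‖ := by
            gcongr
            exact ContinuousLinearMap.le_opNorm B.flip y
        _ = ‖B.flip‖ * ‖u‖ * ‖y‖ := by ring)

theorem inner_operatorOfBilin (B : F →L[ℝ] E →L[ℝ] G) (u : G) (x : F) (y : E) :
    ⟪x, operatorOfBilin B u y⟫_ℝ = ⟪B x y, u⟫_ℝ :=
  ContinuousLinearMap.adjoint_inner_right (B.flip y) x u

end Bilinear

section Matricization

variable {ι : Type*} [Fintype ι] [DecidableEq ι] {H : ι → Type*}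
  [∀ i, NormedAddCommGroup (H i)] [∀ i, InnerProductSpace ℝ (H i)]

variable (H) in
/-- The tensor product of the `H i` over the modes `i ∈ n`. -/
abbrev ModeTensor (n : Finset ι) : Type _ := HilbertTensor (fun i : {i // i ∈ n} => H i)

variable (H) in
/-- The tensor product of the `H i` over the modes `i ∉ n`. -/
abbrev CoModeTensor (n : Finset ι) : Type _ := HilbertTensor (fun i : {i // i ∉ n} => H i)

/-- Gluing vectors indexed by `n` and by its complement. -/
def glue (n : Finset ι) (x : ∀ i : {i // i ∈ n}, H i) (y : ∀ i : {i // i ∉ n}, H i) :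
    ∀ i, H i := fun i => if h : i ∈ n then x ⟨i, h⟩ else y ⟨i, h⟩

variable (H) in
/-- The bilinear map `(x, y) ↦ x ⊗ y` (with the modes put in their places) on algebraic tensors. -/
def algMul (n : Finset ι) :
    AlgTensor (fun i : {i // i ∈ n} => H i) →ₗ[ℝ]
      AlgTensor (fun i : {i // i ∉ n} => H i) →ₗ[ℝ] AlgTensor H :=
  TensorProduct.curry
    ((PiTensorProduct.reindex ℝ H (Equiv.sumCompl (· ∈ n)).symm).symm.toLinearMap ∘ₗ
      (PiTensorProduct.tmulEquivDep ℝ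
        (fun j : {i // i ∈ n} ⊕ {i // i ∉ n} =>
          H ((Equiv.sumCompl (· ∈ n)).symm.symm j))).toLinearMap)

theorem algMul_algPure (n : Finset ι) (x : ∀ i : {i // i ∈ n}, H i)
    (y : ∀ i : {i // i ∉ n}, H i) :
    algMul H n (algPure x) (algPure y) = algPure (glue n x y) := by
  unfold algMul algPure
  erw [TensorProduct.curry_apply, LinearMap.comp_apply, LinearEquiv.coe_coe,
    PiTensorProduct.tmulEquivDep_apply]
  erw [LinearEquiv.symm_apply_eq, PiTensorProduct.reindex_tprod]
  congr 1
  ext j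
  rcases j with ⟨i, hi⟩ | ⟨i, hi⟩
  · simp [glue, hi]
  · simp [glue, hi]

theorem inner_algMul (n : Finset ι) (u u' : AlgTensor (fun i : {i // i ∈ n} => H i))
    (v v' : AlgTensor (fun i : {i // i ∉ n} => H i)) :
    ⟪algMul H n u v, algMul H n u' v'⟫_ℝ = ⟪u, u'⟫_ℝ * ⟪v, v'⟫_ℝ := by
  induction u using algTensor_induction with
  | add u w hu hw => simp only [map_add, LinearMap.add_apply, inner_add_left, hu, hw, add_mul]
  | smul c x =>
  induction u' using algTensor_induction with
  | add u w hu hw => simp only [map_add, LinearMap.add_apply, inner_add_right, hu, hw, add_mul]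
  | smul c' x' =>
  induction v using algTensor_induction with
  | add u w hu hw => simp only [map_add, inner_add_left, hu, hw, mul_add]
  | smul e y =>
  induction v' using algTensor_induction with
  | add u w hu hw => simp only [map_add, inner_add_right, hu, hw, mul_add]
  | smul e' y' =>
    simp only [map_smul, LinearMap.smul_apply, inner_smul_left, inner_smul_right, algMul_algPure,
      inner_algPure, conj_trivial]
    have h : ∏ i, ⟪glue n x y i, glue n x' y' i⟫_ℝ
        = (∏ i, ⟪x i, x' i⟫_ℝ) * ∏ i, ⟪y i, y' i⟫_ℝ := by
      rw [← (Equiv.sumCompl (· ∈ n)).prod_comp, Fintype.prod_sum_type]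
      congr 1
      · refine Finset.prod_congr rfl fun i _ => ?_
        obtain ⟨i, hi⟩ := i
        simp [glue, hi]
        rfl
      · refine Finset.prod_congr rfl fun i _ => ?_
        obtain ⟨i, hi⟩ := i
        simp [glue, hi]
        rfl
    rw [h]
    ring

theorem norm_algMul (n : Finset ι) (u : AlgTensor (fun i : {i // i ∈ n} => H i))
    (v : AlgTensor (fun i : {i // i ∉ n} => H i)) :
    ‖algMul H n u v‖ = ‖u‖ * ‖v‖ := by
  have h : ‖algMul H n u v‖ ^ 2 = (‖u‖ * ‖v‖) ^ 2 := by
    rw [mul_pow, ← real_inner_self_eq_norm_sq, ← real_inner_self_eq_norm_sq,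
      ← real_inner_self_eq_norm_sq, inner_algMul]
  exact (pow_left_inj₀ (norm_nonneg _) (by positivity) two_ne_zero).1 h

variable (H) in
/-- `algMul`, with values in the completed tensor product. -/
def preMul (n : Finset ι) :
    AlgTensor (fun i : {i // i ∈ n} => H i) →L[ℝ]
      AlgTensor (fun i : {i // i ∉ n} => H i) →L[ℝ] HilbertTensor H :=
  LinearMap.mkContinuous₂
    ((algMul H n).compr₂ (UniformSpace.Completion.toComplL (𝕜 := ℝ)
      (E := AlgTensor H)).toLinearMap) 1
    (fun u v => by
      change ‖((algMul H n u v : AlgTensor H) : HilbertTensor H)‖ ≤ _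
      rw [UniformSpace.Completion.norm_coe, norm_algMul, one_mul])

variable (H) in
/-- The continuous bilinear map `(x, y) ↦ x ⊗ y` on the completed tensor products over the modes
in `n` and over the remaining modes. -/
def tensorMul (n : Finset ι) : ModeTensor H n →L[ℝ] CoModeTensor H n →L[ℝ] HilbertTensor H :=
  (((preMul H n).extend UniformSpace.Completion.toComplL).flip.extend
    UniformSpace.Completion.toComplL).flip

theorem tensorMul_coe (n : Finset ι) (u : AlgTensor (fun i : {i // i ∈ n} => H i))
    (v : AlgTensor (fun i : {i // i ∉ n} => H i)) :
    tensorMul H n u v = (algMul H n u v : AlgTensor H) := by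
  have hd1 : DenseRange (UniformSpace.Completion.toComplL (𝕜 := ℝ)
      (E := AlgTensor (fun i : {i // i ∈ n} => H i))) :=
    UniformSpace.Completion.denseRange_coe
  have hu1 : IsUniformInducing (UniformSpace.Completion.toComplL (𝕜 := ℝ)
      (E := AlgTensor (fun i : {i // i ∈ n} => H i))) :=
    UniformSpace.Completion.isUniformInducing_coe _
  have hd2 : DenseRange (UniformSpace.Completion.toComplL (𝕜 := ℝ)
      (E := AlgTensor (fun i : {i // i ∉ n} => H i))) :=
    UniformSpace.Completion.denseRange_coe
  have hu2 : IsUniformInducing (UniformSpace.Completion.toComplL (𝕜 := ℝ)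
      (E := AlgTensor (fun i : {i // i ∉ n} => H i))) :=
    UniformSpace.Completion.isUniformInducing_coe _
  have h1 := ContinuousLinearMap.extend_eq
    ((preMul H n).extend UniformSpace.Completion.toComplL).flip hd2 hu2 v
  have h2 := ContinuousLinearMap.extend_eq (preMul H n) hd1 hu1 u
  have h3 := congrArg (fun L => L (u : ModeTensor H n)) h1
  simp only [ContinuousLinearMap.flip_apply] at h3
  exact h3.trans (congrArg (fun L => L v) h2)

/-- The matricization of `u` with respect to `n`: the operator from the tensor product over the
modes outside `n` to the tensor product over the modes in `n` that is determined by
`⟪x, M u y⟫ = ⟪x ⊗ y, u⟫`. -/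
def matricization (n : Finset ι) (u : HilbertTensor H) :
    CoModeTensor H n →L[ℝ] ModeTensor H n :=
  operatorOfBilin (tensorMul H n) u

theorem inner_matricization (n : Finset ι) (u : HilbertTensor H) (x : ModeTensor H n)
    (y : CoModeTensor H n) : ⟪x, matricization n u y⟫_ℝ = ⟪tensorMul H n x y, u⟫_ℝ :=
  inner_operatorOfBilin _ _ _ _

/-- The inverse of the matricization, turning a Hilbert-Schmidt operator back into a tensor.
(`matricization n` is injective, with the Hilbert-Schmidt operators as its range.) -/
def tensorize (n : Finset ι) : (CoModeTensor H n →L[ℝ] ModeTensor H n) → HilbertTensor H :=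
  Function.invFun (matricization n)

end Matricization

/-! ### Singular values and soft thresholding of operators -/

section SoftThresholding

variable {E F : Type*} [NormedAddCommGroup E] [InnerProductSpace ℝ E]
  [NormedAddCommGroup F] [InnerProductSpace ℝ F]

/-- `(σ, f, g)` is a singular value decomposition `X = ∑ k, σ k ⟪g k, ·⟫ f k`: the sequence `σ` is
nonnegative and nonincreasing, and the `f k` and the `g k` with `σ k ≠ 0` are orthonormal. Sequences
are indexed by `ℕ` from `0` and `σ` is extended by zero if `X` has finite rank. -/
structure IsSVD (X : E →L[ℝ] F) (σ : ℕ → ℝ) (f : ℕ → F) (g : ℕ → E) : Prop where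
  nonneg : ∀ k, 0 ≤ σ k
  antitone : Antitone σ
  orthonormal_left : Orthonormal ℝ (fun k : {k // σ k ≠ 0} => f k)
  orthonormal_right : Orthonormal ℝ (fun k : {k // σ k ≠ 0} => g k)
  hasSum : HasSum (fun k => σ k • InnerProductSpace.rankOne ℝ (f k) (g k)) X

open Classical in
/-- A singular value decomposition of `X` (every compact operator has one). -/
def svd (X : E →L[ℝ] F) : (ℕ → ℝ) × (ℕ → F) × (ℕ → E) :=
  if h : ∃ p : (ℕ → ℝ) × (ℕ → F) × (ℕ → E), IsSVD X p.1 p.2.1 p.2.2 then h.choose else 0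

/-- The nonincreasing sequence of the singular values of `X`, indexed from `0`; it does not
depend on the choice of the singular value decomposition. -/
def singularValue (X : E →L[ℝ] F) : ℕ → ℝ := (svd X).1

/-- Soft thresholding of real numbers. -/
def softThr (α x : ℝ) : ℝ := Real.sign x * max (|x| - α) 0

/-- Soft thresholding of the singular values of an operator; it does not depend on the choice
of the singular value decomposition. -/
def softThrOp (α : ℝ) (X : E →L[ℝ] F) : E →L[ℝ] F :=
  ∑' k, softThr α ((svd X).1 k) • InnerProductSpace.rankOne ℝ ((svd X).2.1 k) ((svd X).2.2 k)

end SoftThresholding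

/-! ### Dimension trees and their edges -/

section Trees

variable {ι : Type*} [DecidableEq ι]

/-- `IsDimTree r T`: the set of nodes `T` is a binary dimension tree with root `r`. The leaves are
singletons, and every other node is the disjoint union of its two sons. -/
inductive IsDimTree : Finset ι → Finset (Finset ι) → Prop
  | leaf (i : ι) : IsDimTree {i} {{i}}
  | node {r₁ r₂ : Finset ι} {T₁ T₂ : Finset (Finset ι)} (h₁ : IsDimTree r₁ T₁)
      (h₂ : IsDimTree r₂ T₂) (hd : Disjoint r₁ r₂) :
      IsDimTree (r₁ ∪ r₂) (insert (r₁ ∪ r₂) (T₁ ∪ T₂))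

/-- The edges `{n, nᶜ}` of a dimension tree, as unordered pairs, where `n` runs through the nodes
other than the root `univ`. -/
def edges [Fintype ι] (T : Finset (Finset ι)) : Finset (Sym2 (Finset ι)) :=
  (T.erase Finset.univ).image (fun n => s(n, nᶜ))

/-- An enumeration `{n t, (n t)ᶜ}` of the edges of `T`, each edge occurring exactly once. -/
def IsEdgeEnumeration [Fintype ι] (T : Finset (Finset ι)) (n : Fin (edges T).card → Finset ι) :
    Prop :=
  Set.BijOn (fun t => s(n t, (n t)ᶜ)) Set.univ (edges T : Set (Sym2 (Finset ι)))

end Trees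

/-! ### Hierarchical singular values and soft thresholding of tensors -/

section Hierarchical

variable {ι : Type*} [Fintype ι] [DecidableEq ι] {H : ι → Type*}
  [∀ i, NormedAddCommGroup (H i)] [∀ i, InnerProductSpace ℝ (H i)]

/-- The singular values `σ_n(u)` of the matricization of `u` with respect to `n`; the `k`-th
singular value, `k ≥ 1`, is `hsv n u (k - 1)`. -/
def hsv (n : Finset ι) (u : HilbertTensor H) : ℕ → ℝ := singularValue (matricization n u)

/-- The rank of the matricization of `u` with respect to `n`. -/
def hrank (n : Finset ι) (u : HilbertTensor H) : Cardinal :=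
  (matricization n u).toLinearMap.rank

/-- Soft thresholding of the matricization with respect to `n`. -/
def softThrMode (n : Finset ι) (α : ℝ) (u : HilbertTensor H) : HilbertTensor H :=
  tensorize n (softThrOp α (matricization n u))

/-- Hierarchical soft thresholding: successive soft thresholding with respect to `n 0`, `n 1`, …,
in this order. -/
def softThrTensor {E : ℕ} (n : Fin E → Finset ι) (α : ℝ) (u : HilbertTensor H) :
    HilbertTensor H :=
  (List.ofFn n).foldl (fun v m => softThrMode m α v) u

/-- The best approximation error `inf {‖u - w‖ : rank_n(w) ≤ r}`. -/
def bestApproxError (n : Finset ι) (r : ℕ) (u : HilbertTensor H) : ℝ :=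
  ⨅ w : {w : HilbertTensor H // hrank n w ≤ r}, ‖u - w.1‖

/-- The set of all `r ≥ 1` such that the `r`-th singular value exceeds `δ`, together with `0`. -/
def rankSet (n : Finset ι) (δ : ℝ) (u : HilbertTensor H) : Set ℕ :=
  {r : ℕ | 1 ≤ r ∧ δ < hsv n u (r - 1)} ∪ {0}

/-- The maximum of `rankSet`. -/
def thrRank (n : Finset ι) (δ : ℝ) (u : HilbertTensor H) : ℕ := sSup (rankSet n δ u)

/-- The `ℓ₂` distance of the singular values before and after soft thresholding. -/
def thrDist (n : Finset ι) (α : ℝ) (u : HilbertTensor H) : ℝ :=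
  √(∑' k, (hsv n (softThrMode n α u) k - hsv n u k) ^ 2)

end Hierarchical

end HTensor

end

noncomputable section

namespace HTensor

open scoped TensorProduct InnerProductSpace

/-! ### Orthogonal series -/

section OrthogonalSeries

variable {V : Type*} [NormedAddCommGroup V] [InnerProductSpace ℝ V]

/-! Fix an edge. Its product map `B` is multiplicative for inner products and has total range
(`IsTensorPairing`), so a singular value decomposition of a matricization is the same as an
orthogonal expansion `u = ∑ σ k • B (f k) (g k)` of the tensor. Such an expansion exists because
matricizations are compact. Parseval gives square summability of `σ`, and truncation together with
Mirsky's inequality gives the best approximation error. The formula for `thrDist` follows since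
thresholding changes each singular value `σ k` by `min (σ k) α`.

The upper bound rests on nonexpansiveness of soft thresholding (`IsSoftThr.norm_sub_le`): it is the
proximal map of `α` times the nuclear norm. Comparing the remaining thresholdings started at `S u`
and at `u` costs at most `‖S u - u‖`, and induction sums these costs, all evaluated at the original
`u`.

The lower bound needs that thresholding along one edge does not increase any singular value along
another edge (`IsSoftThr.hsv_le`). Nodes of a tree are nested or disjoint, so one side of the first
edge lies inside one side of the second. The orthogonality of the singular vectors on that side
survives the second matricization (or its transpose), so `‖M u y‖ ^ 2` is a sum of `σ k ^ 2` with
nonnegative weights, and shrinking `σ` shrinks it for every `y`. The min-max principle turns this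
into an inequality of singular values. Hence the final singular values along each edge are at most
the thresholded original ones, and Mirsky's inequality (`IsTensorSVD.hasSum_sub_sq_le`) converts
this gap into a lower bound for the norm. -/

theorem hasSum_norm_sq_of_pairwise_inner_eq_zero {z : ℕ → V} {w : V} (h : HasSum z w)
    (hz : ∀ j k, j ≠ k → ⟪z j, z k⟫_ℝ = 0) : HasSum (fun k => ‖z k‖ ^ 2) (‖w‖ ^ 2) := by
  have h1 : ∀ k, ⟪z k, w⟫_ℝ = ‖z k‖ ^ 2 := fun k => by
    have h2 : HasSum (fun j => ⟪z k, z j⟫_ℝ) ⟪z k, w⟫_ℝ := (innerSL ℝ (z k)).hasSum h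
    rw [← real_inner_self_eq_norm_sq]
    exact h2.unique (hasSum_single k fun j hj => hz k j hj.symm)
  have h3 : HasSum (fun j => ⟪w, z j⟫_ℝ) ⟪w, w⟫_ℝ := (innerSL ℝ w).hasSum h
  rw [real_inner_self_eq_norm_sq] at h3
  exact h3.congr_fun fun k => by rw [real_inner_comm, h1]

variable {σ : ℕ → ℝ} {f : ℕ → V}

theorem inner_of_orthonormal_support (hf : Orthonormal ℝ (fun k : {k // σ k ≠ 0} => f k))
    {j k : ℕ} (hj : σ j ≠ 0) (hk : σ k ≠ 0) : ⟪f j, f k⟫_ℝ = if j = k then 1 else 0 := by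
  classical
  simpa using orthonormal_iff_ite.1 hf ⟨j, hj⟩ ⟨k, hk⟩

theorem norm_of_orthonormal_support (hf : Orthonormal ℝ (fun k : {k // σ k ≠ 0} => f k))
    {k : ℕ} (hk : σ k ≠ 0) : ‖f k‖ = 1 := hf.1 ⟨k, hk⟩

/-- Bessel's inequality. Indices with `σ k = 0` are masked because the vectors there are arbitrary.
-/
theorem sum_inner_sq_le (hf : Orthonormal ℝ (fun k : {k // σ k ≠ 0} => f k)) (s : Finset ℕ)
    (x : V) : ∑ k ∈ s, (if σ k = 0 then 0 else ⟪f k, x⟫_ℝ ^ 2) ≤ ‖x‖ ^ 2 := by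
  have h := hf.sum_inner_products_le x (s := s.subtype (fun k => σ k ≠ 0))
  rw [Finset.sum_subtype_eq_sum_filter (f := fun k => ‖⟪f k, x⟫_ℝ‖ ^ 2), Finset.sum_filter] at h
  refine le_trans (le_of_eq ?_) h
  refine Finset.sum_congr rfl fun k _ => ?_
  by_cases hk : σ k = 0 <;> simp [hk]

theorem orthonormal_support_mono {τ : ℕ → ℝ} (h : ∀ k, σ k = 0 → τ k = 0)
    (hf : Orthonormal ℝ (fun k : {k // σ k ≠ 0} => f k)) :
    Orthonormal ℝ (fun k : {k // τ k ≠ 0} => f k) :=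
  hf.comp (fun k : {k // τ k ≠ 0} => (⟨k, fun hk => k.2 (h k hk)⟩ : {k // σ k ≠ 0}))
    fun a b hab => by simpa [Subtype.ext_iff] using hab

theorem summable_smul_of_orthonormal_support [CompleteSpace V]
    (hf : Orthonormal ℝ (fun k : {k // σ k ≠ 0} => f k)) (hσ : Summable fun k => σ k ^ 2) :
    Summable fun k => σ k • f k := by
  rw [summable_iff_vanishing_norm] at hσ ⊢
  intro ε hε
  obtain ⟨s, hs⟩ := hσ (ε ^ 2) (by positivity)
  refine ⟨s, fun t ht => ?_⟩
  have h1 := hs t ht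
  have h2 : ‖∑ k ∈ t, σ k • f k‖ ^ 2 = ∑ k ∈ t, σ k ^ 2 := by
    rw [← real_inner_self_eq_norm_sq, sum_inner]
    refine Finset.sum_congr rfl fun j hj => ?_
    rw [inner_sum, Finset.sum_eq_single_of_mem j hj]
    · by_cases h : σ j = 0
      · simp [h]
      · rw [real_inner_self_eq_norm_sq, norm_smul, norm_of_orthonormal_support hf h, mul_one,
          Real.norm_eq_abs, sq_abs]
    · intro k _ hkj
      by_cases h : σ j = 0
      · simp [h]
      by_cases h' : σ k = 0
      · simp [h']
      simp [inner_smul_left, inner_smul_right, inner_of_orthonormal_support hf h h', hkj.symm]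
  rw [← h2, Real.norm_of_nonneg (by positivity)] at h1
  exact lt_of_pow_lt_pow_left₀ 2 hε.le h1

end OrthogonalSeries

/-! ### Tensor pairings and their singular value decompositions -/

section Pairing

variable {E F G : Type*} [NormedAddCommGroup E] [InnerProductSpace ℝ E]
  [NormedAddCommGroup F] [InnerProductSpace ℝ F]
  [NormedAddCommGroup G] [InnerProductSpace ℝ G]

/-- A bilinear map exhibiting `G` as the Hilbert space tensor product of `F` and `E`. -/
structure IsTensorPairing (B : F →L[ℝ] E →L[ℝ] G) : Prop where
  inner_apply : ∀ x y x' y', ⟪B x y, B x' y'⟫_ℝ = ⟪x, x'⟫_ℝ * ⟪y, y'⟫_ℝ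
  eq_zero : ∀ u, (∀ x y, ⟪B x y, u⟫_ℝ = 0) → u = 0

/-- A singular value decomposition `u = ∑ k, σ k • (f k ⊗ g k)` of a tensor. -/
structure IsTensorSVD (B : F →L[ℝ] E →L[ℝ] G) (u : G) (σ : ℕ → ℝ) (f : ℕ → F) (g : ℕ → E) :
    Prop where
  nonneg : ∀ k, 0 ≤ σ k
  antitone : Antitone σ
  orthonormal_left : Orthonormal ℝ (fun k : {k // σ k ≠ 0} => f k)
  orthonormal_right : Orthonormal ℝ (fun k : {k // σ k ≠ 0} => g k)
  hasSum : HasSum (fun k => σ k • B (f k) (g k)) u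

variable {B : F →L[ℝ] E →L[ℝ] G} {u v : G} {σ τ : ℕ → ℝ} {f f' : ℕ → F} {g g' : ℕ → E}

theorem IsTensorPairing.flip (hB : IsTensorPairing B) : IsTensorPairing B.flip where
  inner_apply x y x' y' := by simp [hB.inner_apply, mul_comm]
  eq_zero u h := hB.eq_zero u fun x y => h y x

theorem IsTensorSVD.flip (h : IsTensorSVD B u σ f g) : IsTensorSVD B.flip u σ g f :=
  ⟨h.nonneg, h.antitone, h.orthonormal_right, h.orthonormal_left, h.hasSum⟩

theorem IsTensorPairing.norm_apply (hB : IsTensorPairing B) (x : F) (y : E) :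
    ‖B x y‖ = ‖x‖ * ‖y‖ := by
  have h : ‖B x y‖ ^ 2 = (‖x‖ * ‖y‖) ^ 2 := by
    rw [mul_pow, ← real_inner_self_eq_norm_sq, hB.inner_apply, real_inner_self_eq_norm_sq,
      real_inner_self_eq_norm_sq]
  exact (pow_left_inj₀ (norm_nonneg _) (by positivity) two_ne_zero).1 h

theorem IsTensorPairing.orthonormal (hB : IsTensorPairing B)
    (hf : Orthonormal ℝ (fun k : {k // σ k ≠ 0} => f k))
    (hg : Orthonormal ℝ (fun k : {k // σ k ≠ 0} => g k)) :
    Orthonormal ℝ (fun k : {k // σ k ≠ 0} => B (f k) (g k)) := by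
  refine ⟨fun k => by rw [hB.norm_apply, hf.1 k, hg.1 k, one_mul], fun j k hjk => ?_⟩
  dsimp only
  rw [hB.inner_apply, hf.2 hjk, zero_mul]

theorem IsTensorSVD.inner_eq (hB : IsTensorPairing B) (h : IsTensorSVD B u σ f g) {k : ℕ}
    (hk : σ k ≠ 0) : ⟪B (f k) (g k), u⟫_ℝ = σ k := by
  have ho := hB.orthonormal h.orthonormal_left h.orthonormal_right
  have h1 := (innerSL ℝ (B (f k) (g k))).hasSum h.hasSum
  refine h1.unique ?_
  have h2 : ⟪B (f k) (g k), σ k • B (f k) (g k)⟫_ℝ = σ k := by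
    rw [inner_smul_right, inner_of_orthonormal_support (f := fun k => B (f k) (g k)) ho hk hk]
    simp
  suffices h3 : HasSum (fun j => ⟪B (f k) (g k), σ j • B (f j) (g j)⟫_ℝ)
      ⟪B (f k) (g k), σ k • B (f k) (g k)⟫_ℝ by rwa [h2] at h3
  refine hasSum_single k fun j hj => ?_
  by_cases hj0 : σ j = 0
  · simp [hj0]
  · rw [inner_smul_right, inner_of_orthonormal_support (f := fun k => B (f k) (g k)) ho hk hj0]
    simp [hj.symm]

theorem IsTensorSVD.hasSum_sq (hB : IsTensorPairing B) (h : IsTensorSVD B u σ f g) :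
    HasSum (fun k => σ k ^ 2) (‖u‖ ^ 2) := by
  have ho := hB.orthonormal h.orthonormal_left h.orthonormal_right
  refine (hasSum_norm_sq_of_pairwise_inner_eq_zero h.hasSum fun j k hjk => ?_).congr_fun
    fun k => ?_
  · by_cases hj : σ j = 0
    · simp [hj]
    by_cases hk : σ k = 0
    · simp [hk]
    rw [inner_smul_left, inner_smul_right,
      inner_of_orthonormal_support (f := fun k => B (f k) (g k)) ho hj hk]
    simp [hjk]
  · by_cases hk : σ k = 0
    · simp [hk]
    · simp [norm_smul, norm_of_orthonormal_support (f := fun k => B (f k) (g k)) ho hk]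

theorem IsTensorSVD.tendsto_zero (hB : IsTensorPairing B) (h : IsTensorSVD B u σ f g) :
    Filter.Tendsto σ Filter.atTop (nhds 0) := by
  have h1 := (h.hasSum_sq hB).summable.tendsto_atTop_zero
  have h2 := (Real.continuous_sqrt.tendsto 0).comp h1
  rw [Real.sqrt_zero] at h2
  exact h2.congr fun k => Real.sqrt_sq (h.nonneg k)

/-- Bessel's inequality in `G` bounds the sum by `‖u‖ ^ 2`. This gives square summability before an
expansion of `u` is available. -/
theorem summable_sq_of_inner_eq (hB : IsTensorPairing B)
    (hf : Orthonormal ℝ (fun k : {k // σ k ≠ 0} => f k))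
    (hg : Orthonormal ℝ (fun k : {k // σ k ≠ 0} => g k))
    (h : ∀ k, σ k ≠ 0 → ⟪B (f k) (g k), u⟫_ℝ = σ k) : Summable fun k => σ k ^ 2 := by
  refine summable_of_sum_le (fun k => sq_nonneg _) (c := ‖u‖ ^ 2) fun s => ?_
  refine le_trans (le_of_eq (Finset.sum_congr rfl fun k _ => ?_))
    (sum_inner_sq_le (f := fun k => B (f k) (g k)) (hB.orthonormal hf hg) s u)
  by_cases hk : σ k = 0
  · simp [hk]
  · simp [hk, h k hk]

theorem IsSVD.apply_right {X : E →L[ℝ] F} (h : IsSVD X σ f g) {k : ℕ} (hk : σ k ≠ 0) :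
    X (g k) = σ k • f k := by
  have h1 : HasSum (fun j => σ j • (⟪g j, g k⟫_ℝ • f j)) (X (g k)) := by
    have h0 := ContinuousLinearMap.hasSum (ContinuousLinearMap.apply ℝ F (g k)) h.hasSum
    simpa only [ContinuousLinearMap.apply_apply, smul_apply,
      InnerProductSpace.rankOne_apply] using h0
  have h2 : σ k • (⟪g k, g k⟫_ℝ • f k) = σ k • f k := by
    rw [inner_of_orthonormal_support h.orthonormal_right hk hk, if_pos rfl, one_smul]
  have h3 : HasSum (fun j => σ j • (⟪g j, g k⟫_ℝ • f j)) (σ k • (⟪g k, g k⟫_ℝ • f k)) := by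
    refine hasSum_single k fun j hj => ?_
    by_cases hj0 : σ j = 0
    · rw [hj0, zero_smul]
    · rw [inner_of_orthonormal_support h.orthonormal_right hj0 hk, if_neg hj, zero_smul, smul_zero]
  exact (h1.unique h3).trans h2

end Pairing

/-! ### Passing between tensor and operator decompositions -/

section Matrix

variable {E F G : Type*} [NormedAddCommGroup E] [InnerProductSpace ℝ E]
  [NormedAddCommGroup F] [InnerProductSpace ℝ F] [CompleteSpace F]
  [NormedAddCommGroup G] [InnerProductSpace ℝ G] [CompleteSpace G]
  {B : F →L[ℝ] E →L[ℝ] G} {u v : G} {σ τ : ℕ → ℝ} {f f' : ℕ → F} {g g' : ℕ → E}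

/-- `operatorOfBilin` as a continuous linear map in the tensor. -/
def operatorOfBilinL (B : F →L[ℝ] E →L[ℝ] G) : G →L[ℝ] E →L[ℝ] F :=
  LinearMap.mkContinuous
    { toFun := operatorOfBilin B
      map_add' := fun u v => by
        ext y
        refine ext_inner_left ℝ fun x => ?_
        simp [inner_add_right, inner_operatorOfBilin]
      map_smul' := fun c u => by
        ext y
        refine ext_inner_left ℝ fun x => ?_
        simp [inner_smul_right, inner_operatorOfBilin] }
    ‖B.flip‖ (fun u => by
      change ‖operatorOfBilin B u‖ ≤ _
      unfold operatorOfBilin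
      exact LinearMap.mkContinuous_norm_le _ (by positivity) _)

theorem operatorOfBilinL_apply (B : F →L[ℝ] E →L[ℝ] G) (u : G) :
    operatorOfBilinL B u = operatorOfBilin B u := rfl

theorem IsTensorPairing.operatorOfBilin_apply_apply (hB : IsTensorPairing B) (x : F) (y : E) :
    operatorOfBilin B (B x y) = InnerProductSpace.rankOne ℝ x y := by
  ext z
  refine ext_inner_left ℝ fun w => ?_
  rw [inner_operatorOfBilin, hB.inner_apply, InnerProductSpace.rankOne_apply, inner_smul_right,
    real_inner_comm z y, mul_comm]

theorem IsTensorPairing.operatorOfBilin_injective (hB : IsTensorPairing B) :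
    Function.Injective (operatorOfBilin B) := by
  intro u v huv
  refine sub_eq_zero.1 (hB.eq_zero _ fun x y => ?_)
  rw [inner_sub_right, ← inner_operatorOfBilin, ← inner_operatorOfBilin, huv, sub_self]

theorem IsTensorSVD.isSVD (hB : IsTensorPairing B) (h : IsTensorSVD B u σ f g) :
    IsSVD (operatorOfBilin B u) σ f g := by
  refine ⟨h.nonneg, h.antitone, h.orthonormal_left, h.orthonormal_right, ?_⟩
  refine ((operatorOfBilinL B).hasSum h.hasSum).congr_fun fun k => ?_
  simp [operatorOfBilinL_apply, hB.operatorOfBilin_apply_apply]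

/-- The given series converges only in operator norm. Square summability makes the tensor series
converge in `G`, and its limit is `u` because it has the same matricization. -/
theorem IsSVD.isTensorSVD (hB : IsTensorPairing B) (h : IsSVD (operatorOfBilin B u) σ f g) :
    IsTensorSVD B u σ f g := by
  refine ⟨h.nonneg, h.antitone, h.orthonormal_left, h.orthonormal_right, ?_⟩
  have hs := summable_smul_of_orthonormal_support (f := fun k => B (f k) (g k))
    (hB.orthonormal h.orthonormal_left h.orthonormal_right)
    (summable_sq_of_inner_eq (u := u) hB h.orthonormal_left h.orthonormal_right fun k hk => by
      rw [← inner_operatorOfBilin, h.apply_right hk, inner_smul_right,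
        inner_of_orthonormal_support h.orthonormal_left hk hk]
      simp)
  have h1 := hs.hasSum
  have h2 : IsTensorSVD B (∑' k, σ k • B (f k) (g k)) σ f g :=
    ⟨h.nonneg, h.antitone, h.orthonormal_left, h.orthonormal_right, h1⟩
  rwa [hB.operatorOfBilin_injective ((h2.isSVD hB).hasSum.unique h.hasSum)] at h1

end Matrix

/-! ### Existence of singular value decompositions -/

section Deflation

variable {E F : Type*} [NormedAddCommGroup E] [InnerProductSpace ℝ E]
  [NormedAddCommGroup F] [InnerProductSpace ℝ F]

theorem isCompactOperator_rankOne (x : F) (y : E) :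
    IsCompactOperator (InnerProductSpace.rankOne ℝ x y) := by
  rw [InnerProductSpace.rankOne_def']
  exact IsCompactOperator.comp_clm
    (isCompactOperator_of_locallyCompactSpace_rng (ContinuousLinearMap.toSpanSingleton ℝ x))
    (innerSL ℝ y)

/-- Successive removal of leading singular components from the operator `Y 0`. -/
structure IsDeflation (Y : ℕ → E →L[ℝ] F) (f : ℕ → F) (g : ℕ → E) : Prop where
  succ : ∀ k, Y (k + 1) = Y k - ‖Y k‖ • InnerProductSpace.rankOne ℝ (f k) (g k)
  apply_right : ∀ k, Y k (g k) = ‖Y k‖ • f k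
  inner_left : ∀ k z, ⟪f k, Y k z⟫_ℝ = ‖Y k‖ * ⟪g k, z⟫_ℝ
  -- Required also when `‖Y k‖ = 0`, where `f k` and `g k` need not be unit vectors; the
  -- construction below takes both zero there.
  norm_left_le : ∀ k, ‖f k‖ ≤ 1
  norm_left : ∀ k, ‖Y k‖ ≠ 0 → ‖f k‖ = 1
  norm_right : ∀ k, ‖Y k‖ ≠ 0 → ‖g k‖ = 1

namespace IsDeflation

variable {Y : ℕ → E →L[ℝ] F} {f : ℕ → F} {g : ℕ → E}

theorem succ_apply (h : IsDeflation Y f g) (k : ℕ) (z : E) :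
    Y (k + 1) z = Y k z - (‖Y k‖ * ⟪g k, z⟫_ℝ) • f k := by
  rw [h.succ, mul_smul]
  simp

/-- By `inner_left`, the removed term is `⟪f k, Y k z⟫ • f k`, and subtracting it cannot lengthen `Y
k z` when `‖f k‖ ≤ 1`. -/
theorem antitone_norm (h : IsDeflation Y f g) : Antitone fun k => ‖Y k‖ := by
  refine antitone_nat_of_succ_le fun k => ?_
  refine ContinuousLinearMap.opNorm_le_bound _ (norm_nonneg _) fun z => ?_
  refine le_trans ?_ ((Y k).le_opNorm z)
  rw [h.succ_apply, ← h.inner_left]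
  refine le_of_sq_le_sq ?_ (norm_nonneg _)
  rw [norm_sub_sq_real, inner_smul_right, norm_smul, real_inner_comm (f k), mul_pow,
    Real.norm_eq_abs, sq_abs]
  have h1 : ‖f k‖ ^ 2 ≤ 1 := pow_le_one₀ (norm_nonneg _) (h.norm_left_le k)
  nlinarith [sq_nonneg ⟪f k, Y k z⟫_ℝ]

theorem apply_right_of_lt (h : IsDeflation Y f g) {j k : ℕ} (hjk : j < k) (hj : ‖Y j‖ ≠ 0) :
    Y k (g j) = 0 := by
  induction k, hjk using Nat.le_induction with
  | base =>
    rw [h.succ_apply, h.apply_right, real_inner_self_eq_norm_sq, h.norm_right j hj]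
    simp
  | succ k hk ih => rw [h.succ_apply, ← h.inner_left, ih, inner_zero_right, zero_smul, sub_zero]

theorem inner_left_of_lt (h : IsDeflation Y f g) {j k : ℕ} (hjk : j < k) (hj : ‖Y j‖ ≠ 0)
    (z : E) : ⟪f j, Y k z⟫_ℝ = 0 := by
  induction k, hjk using Nat.le_induction generalizing z with
  | base =>
    rw [h.succ_apply, inner_sub_right, inner_smul_right, h.inner_left,
      real_inner_self_eq_norm_sq, h.norm_left j hj]
    simp
  | succ k hk ih =>
    have h1 := ih (g k)
    rw [h.apply_right, inner_smul_right] at h1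
    rw [h.succ_apply, inner_sub_right, inner_smul_right, ih, mul_right_comm, h1]
    simp

theorem orthonormal_left (h : IsDeflation Y f g) :
    Orthonormal ℝ (fun k : {k // ‖Y k‖ ≠ 0} => f k) := by
  have key : ∀ j k, j < k → ‖Y j‖ ≠ 0 → ‖Y k‖ ≠ 0 → ⟪f j, f k⟫_ℝ = 0 := by
    intro j k hjk hj hk
    have h1 := h.inner_left_of_lt hjk hj (g k)
    rw [h.apply_right, inner_smul_right] at h1
    exact (mul_eq_zero.1 h1).resolve_left hk
  refine ⟨fun k => h.norm_left k k.2, fun j k hjk => ?_⟩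
  rcases lt_or_gt_of_ne (fun e => hjk (Subtype.ext e) : (j : ℕ) ≠ k) with hlt | hlt
  · exact key j k hlt j.2 k.2
  · exact (real_inner_comm _ _).trans (key k j hlt k.2 j.2)

theorem orthonormal_right (h : IsDeflation Y f g) :
    Orthonormal ℝ (fun k : {k // ‖Y k‖ ≠ 0} => g k) := by
  have key : ∀ j k, j < k → ‖Y j‖ ≠ 0 → ‖Y k‖ ≠ 0 → ⟪g k, g j⟫_ℝ = 0 := by
    intro j k hjk hj hk
    have h1 := h.inner_left k (g j)
    rw [h.apply_right_of_lt hjk hj, inner_zero_right] at h1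
    exact (mul_eq_zero.1 h1.symm).resolve_left hk
  refine ⟨fun k => h.norm_right k k.2, fun j k hjk => ?_⟩
  rcases lt_or_gt_of_ne (fun e => hjk (Subtype.ext e) : (j : ℕ) ≠ k) with hlt | hlt
  · exact (real_inner_comm _ _).trans (key j k hlt j.2 k.2)
  · exact key k j hlt k.2 j.2

theorem zero_eq_add_sum (h : IsDeflation Y f g) (k : ℕ) :
    Y 0 = Y k + ∑ j ∈ Finset.range k, ‖Y j‖ • InnerProductSpace.rankOne ℝ (f j) (g j) := by
  induction k with
  | zero => simp
  | succ k ih =>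
    rw [Finset.sum_range_succ, h.succ, ih]
    abel

theorem inner_zero_apply (h : IsDeflation Y f g) {k : ℕ} (hk : ‖Y k‖ ≠ 0) :
    ⟪f k, Y 0 (g k)⟫_ℝ = ‖Y k‖ := by
  have h1 : Y 0 (g k) = Y k (g k) := by
    rw [h.zero_eq_add_sum k, add_apply, sum_apply, Finset.sum_eq_zero, add_zero]
    intro j hj
    by_cases hj0 : ‖Y j‖ = 0
    · simp [hj0]
    · rw [smul_apply, InnerProductSpace.rankOne_apply, inner_of_orthonormal_support
        (σ := fun k => ‖Y k‖) h.orthonormal_right hj0 hk, if_neg (Finset.mem_range.1 hj).ne]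
      simp
  rw [h1, h.apply_right, inner_smul_right, real_inner_self_eq_norm_sq, h.norm_left k hk]
  simp

end IsDeflation

end Deflation

/-! ### Compactness of matricizations -/

section Compactness

variable {E F G : Type*} [NormedAddCommGroup E] [InnerProductSpace ℝ E]
  [NormedAddCommGroup F] [InnerProductSpace ℝ F] [CompleteSpace F]
  [NormedAddCommGroup G] [InnerProductSpace ℝ G] [CompleteSpace G]
  {B : F →L[ℝ] E →L[ℝ] G}

/-- The tensors with compact operator form a closed subspace. It contains every `B x y`, so its
orthogonal complement vanishes by totality. -/
theorem IsTensorPairing.isCompactOperator (hB : IsTensorPairing B) (u : G) :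
    IsCompactOperator (operatorOfBilin B u) := by
  let K : Submodule ℝ G :=
    (compactOperator (RingHom.id ℝ) E F).comap (operatorOfBilinL B).toLinearMap
  have hK : IsClosed (K : Set G) :=
    isClosed_setOfPred_isCompactOperator.preimage (operatorOfBilinL B).continuous
  have : CompleteSpace K := hK.completeSpace_coe
  have hKtop : K = ⊤ := by
    rw [← Submodule.orthogonal_eq_bot_iff, eq_bot_iff]
    intro v hv
    refine hB.eq_zero v fun x y => ?_
    refine (Submodule.mem_orthogonal K v).1 hv _ ?_
    change IsCompactOperator (operatorOfBilin B (B x y))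
    rw [hB.operatorOfBilin_apply_apply]
    exact isCompactOperator_rankOne x y
  have hu : u ∈ K := hKtop ▸ Submodule.mem_top
  exact hu

end Compactness

section Existence

variable {E F G : Type*} [NormedAddCommGroup E] [InnerProductSpace ℝ E] [CompleteSpace E]
  [NormedAddCommGroup F] [InnerProductSpace ℝ F] [CompleteSpace F]

/-- The norm is maximized at some `y` in the compact closure of the image of the unit ball. Although
`y` need not be in the image, `X.adjoint y` provides the right singular vector, so no weak
compactness is needed. -/
theorem exists_norm_attaining {X : E →L[ℝ] F} (hX : IsCompactOperator X) :
    ∃ (f : F) (g : E), X g = ‖X‖ • f ∧ (∀ z, ⟪f, X z⟫_ℝ = ‖X‖ * ⟪g, z⟫_ℝ) ∧ ‖f‖ ≤ 1 ∧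
      (‖X‖ ≠ 0 → ‖f‖ = 1 ∧ ‖g‖ = 1) := by
  by_cases h0 : ‖X‖ = 0
  · refine ⟨0, 0, by simp, by simp, by simp, fun h => absurd h0 h⟩
  have hpos : 0 < ‖X‖ := lt_of_le_of_ne (norm_nonneg _) (Ne.symm h0)
  have hK := hX.isCompact_closure_image_closedBall (1 : ℝ)
  obtain ⟨y, hyK, hy⟩ := hK.exists_isMaxOn ⟨X 0, subset_closure ⟨0, by simp, rfl⟩⟩
    continuous_norm.continuousOn
  have hy1 : ‖y‖ ≤ ‖X‖ := by
    refine closure_minimal (t := {w | ‖w‖ ≤ ‖X‖}) ?_ (isClosed_le continuous_norm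
      continuous_const) hyK
    rintro _ ⟨z, hz, rfl⟩
    simpa using X.le_of_opNorm_le_of_le le_rfl (mem_closedBall_zero_iff.1 hz)
  have hy2 : ‖X‖ ≤ ‖y‖ := by
    refine ContinuousLinearMap.opNorm_le_of_unit_norm (norm_nonneg _) fun z hz => ?_
    exact hy (subset_closure ⟨z, by simp [hz], rfl⟩)
  have hyX : ‖y‖ = ‖X‖ := le_antisymm hy1 hy2
  -- The bound `⟪y, w⟫ ≤ ‖X.adjoint y‖` holds on the image of the ball, hence on its closure; it is
  -- used at `w = y`.
  have h1 : ‖X‖ ^ 2 ≤ ‖X.adjoint y‖ := by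
    rw [← hyX, ← real_inner_self_eq_norm_sq]
    refine closure_minimal (t := {w | ⟪y, w⟫_ℝ ≤ ‖X.adjoint y‖}) ?_ (isClosed_le
      (by fun_prop) continuous_const) hyK
    rintro _ ⟨z, hz, rfl⟩
    change ⟪y, X z⟫_ℝ ≤ _
    rw [← ContinuousLinearMap.adjoint_inner_left]
    refine (real_inner_le_norm _ _).trans ?_
    exact mul_le_of_le_one_right (norm_nonneg _) (mem_closedBall_zero_iff.1 hz)
  have h2 : ‖X.adjoint y‖ = ‖X‖ ^ 2 := by
    refine le_antisymm ?_ h1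
    refine (X.adjoint.le_opNorm y).trans ?_
    rw [LinearIsometryEquiv.norm_map, hyX, pow_two]
  have hf : ‖‖X‖⁻¹ • y‖ = 1 := by
    rw [norm_smul, norm_inv, norm_norm, hyX, inv_mul_cancel₀ h0]
  have hg : ‖(‖X‖ ^ 2)⁻¹ • X.adjoint y‖ = 1 := by
    rw [norm_smul, h2, norm_inv, norm_pow, norm_norm, inv_mul_cancel₀ (pow_ne_zero 2 h0)]
  have hfg : ∀ z, ⟪‖X‖⁻¹ • y, X z⟫_ℝ = ‖X‖ * ⟪(‖X‖ ^ 2)⁻¹ • X.adjoint y, z⟫_ℝ := fun z => by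
    rw [inner_smul_left, inner_smul_left, ContinuousLinearMap.adjoint_inner_left]
    simp only [conj_trivial]
    field_simp
  refine ⟨‖X‖⁻¹ • y, (‖X‖ ^ 2)⁻¹ • X.adjoint y, ?_, hfg, hf.le, fun _ => ⟨hf, hg⟩⟩
  set f := ‖X‖⁻¹ • y
  set g := (‖X‖ ^ 2)⁻¹ • X.adjoint y
  -- Equality case of Cauchy–Schwarz: `⟪f, X g⟫ = ‖X‖` while `‖X g‖ ≤ ‖X‖`.
  have h3 : ‖X g - ‖X‖ • f‖ ^ 2 ≤ 0 := by
    rw [norm_sub_sq_real, inner_smul_right, real_inner_comm, hfg g, real_inner_self_eq_norm_sq,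
      hg, norm_smul, norm_norm, hf]
    have h4 : ‖X g‖ ≤ ‖X‖ := by simpa [hg] using X.le_opNorm g
    have h5 : ‖X g‖ ^ 2 ≤ ‖X‖ ^ 2 := by gcongr
    linarith
  have h4 : ‖X g - ‖X‖ • f‖ = 0 := by
    have := le_antisymm h3 (sq_nonneg _)
    exact pow_eq_zero_iff two_ne_zero |>.1 this
  exact sub_eq_zero.1 (norm_eq_zero.1 h4)

theorem exists_isDeflation {X : E →L[ℝ] F} (hX : IsCompactOperator X) :
    ∃ (Y : ℕ → E →L[ℝ] F) (f : ℕ → F) (g : ℕ → E), Y 0 = X ∧ IsDeflation Y f g := by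
  have key : ∀ Z : {Z : E →L[ℝ] F // IsCompactOperator Z}, ∃ (f : F) (g : E),
      Z.1 g = ‖Z.1‖ • f ∧ (∀ z, ⟪f, Z.1 z⟫_ℝ = ‖Z.1‖ * ⟪g, z⟫_ℝ) ∧ ‖f‖ ≤ 1 ∧
      (‖Z.1‖ ≠ 0 → ‖f‖ = 1 ∧ ‖g‖ = 1) := fun Z => exists_norm_attaining Z.2
  choose f g h1 h2 h3 h4 using key
  let Y : ℕ → {Z : E →L[ℝ] F // IsCompactOperator Z} := fun k =>
    Nat.rec ⟨X, hX⟩ (fun _ Z => ⟨Z.1 - ‖Z.1‖ • InnerProductSpace.rankOne ℝ (f Z) (g Z),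
      Z.2.sub ((isCompactOperator_rankOne _ _).smul _)⟩) k
  exact ⟨fun k => (Y k).1, fun k => f (Y k), fun k => g (Y k), rfl, fun _ => rfl,
    fun k => h1 (Y k), fun k => h2 (Y k), fun k => h3 (Y k), fun k hk => (h4 (Y k) hk).1,
    fun k hk => (h4 (Y k) hk).2⟩

variable {G : Type*} [NormedAddCommGroup G] [InnerProductSpace ℝ G] [CompleteSpace G]
  {B : F →L[ℝ] E →L[ℝ] G}

theorem IsTensorPairing.exists_isTensorSVD (hB : IsTensorPairing B) (u : G) :
    ∃ σ f g, IsTensorSVD B u σ f g := by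
  obtain ⟨Y, f, g, hY, h⟩ := exists_isDeflation (hB.isCompactOperator u)
  have hsq : Summable fun k => ‖Y k‖ ^ 2 :=
    summable_sq_of_inner_eq (u := u) hB h.orthonormal_left h.orthonormal_right fun k hk => by
      rw [← inner_operatorOfBilin, ← hY, h.inner_zero_apply hk]
  have hs := summable_smul_of_orthonormal_support (f := fun k => B (f k) (g k))
    (hB.orthonormal h.orthonormal_left h.orthonormal_right) hsq
  refine ⟨fun k => ‖Y k‖, f, g, fun k => norm_nonneg _, h.antitone_norm, h.orthonormal_left,
    h.orthonormal_right, ?_⟩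
  have h1 := hs.hasSum
  have h2 := ((operatorOfBilinL B).hasSum h1).tendsto_sum_nat
  -- Square summability forces the norms of the remainders `Y k` to zero, so the deflated parts
  -- exhaust the operator.
  have h3 : Filter.Tendsto (fun k => Y 0 - Y k) Filter.atTop (nhds (Y 0)) := by
    have h4 : Filter.Tendsto Y Filter.atTop (nhds 0) := by
      rw [tendsto_zero_iff_norm_tendsto_zero]
      have h5 := (Real.continuous_sqrt.tendsto 0).comp hsq.tendsto_atTop_zero
      rw [Real.sqrt_zero] at h5
      exact h5.congr fun k => Real.sqrt_sq (norm_nonneg _)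
    simpa using h4.const_sub (Y 0)
  have h4 : operatorOfBilin B (∑' k, ‖Y k‖ • B (f k) (g k)) = operatorOfBilin B u := by
    rw [← hY]
    refine tendsto_nhds_unique h2 (h3.congr fun k => ?_)
    rw [h.zero_eq_add_sum k, add_sub_cancel_left]
    refine Finset.sum_congr rfl fun j _ => ?_
    rw [map_smul, operatorOfBilinL_apply, hB.operatorOfBilin_apply_apply]
  rwa [hB.operatorOfBilin_injective h4] at h1

end Existence

/-! ### Variational properties of singular values -/

section Variational

variable {E F F' : Type*} [NormedAddCommGroup E] [InnerProductSpace ℝ E]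
  [NormedAddCommGroup F] [InnerProductSpace ℝ F] [NormedAddCommGroup F'] [InnerProductSpace ℝ F']
  {X : E →L[ℝ] F} {Y : E →L[ℝ] F'} {σ τ : ℕ → ℝ} {f : ℕ → F} {f' : ℕ → F'} {g g' : ℕ → E}

namespace IsSVD

theorem hasSum_norm_sq_apply (h : IsSVD X σ f g) (y : E) :
    HasSum (fun k => σ k ^ 2 * ⟪g k, y⟫_ℝ ^ 2) (‖X y‖ ^ 2) := by
  have h1 : HasSum (fun j => σ j • (⟪g j, y⟫_ℝ • f j)) (X y) := by
    have h0 := ContinuousLinearMap.hasSum (ContinuousLinearMap.apply ℝ F y) h.hasSum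
    simpa only [ContinuousLinearMap.apply_apply, smul_apply,
      InnerProductSpace.rankOne_apply] using h0
  refine (hasSum_norm_sq_of_pairwise_inner_eq_zero h1 fun j k hjk => ?_).congr_fun fun k => ?_
  · by_cases hj : σ j = 0
    · simp [hj]
    by_cases hk : σ k = 0
    · simp [hk]
    rw [inner_smul_left, inner_smul_left, inner_smul_right, inner_smul_right,
      inner_of_orthonormal_support h.orthonormal_left hj hk, if_neg hjk]
    simp
  · by_cases hk : σ k = 0
    · simp [hk]
    · rw [norm_smul, norm_smul, norm_of_orthonormal_support h.orthonormal_left hk, mul_one,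
        mul_pow, Real.norm_eq_abs, Real.norm_eq_abs, sq_abs, sq_abs]

theorem norm_apply_le (h : IsSVD X σ f g) {k : ℕ} {y : E} (hy : ∀ j < k, ⟪g j, y⟫_ℝ = 0) :
    ‖X y‖ ≤ σ k * ‖y‖ := by
  refine le_of_sq_le_sq ?_ (mul_nonneg (h.nonneg k) (norm_nonneg _))
  rw [mul_pow]
  refine hasSum_le_of_sum_le (h.hasSum_norm_sq_apply y) fun s => ?_
  refine le_trans ?_ (mul_le_mul_of_nonneg_left
    (sum_inner_sq_le h.orthonormal_right s y) (sq_nonneg (σ k)))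
  rw [Finset.mul_sum]
  refine Finset.sum_le_sum fun j _ => ?_
  by_cases hj0 : σ j = 0
  · simp [hj0]
  rw [if_neg hj0]
  rcases lt_or_ge j k with hj | hj
  · simp [hy j hj]
  · have := h.antitone hj
    have := h.nonneg j
    gcongr

/-- Min-max by counting dimensions: the span of `g' 0, …, g' k` meets the orthogonal complement of
`g 0, …, g (k - 1)` nontrivially. On a common vector `Y` stretches by at least `τ k` and `X` by at
most `σ k`. Applied with `X = Y` it gives uniqueness of singular values. -/
theorem le_of_norm_apply_le (hX : IsSVD X σ f g) (hY : IsSVD Y τ f' g')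
    (h : ∀ y, ‖Y y‖ ≤ ‖X y‖) (k : ℕ) : τ k ≤ σ k := by
  by_contra! hlt
  have hτ : ∀ j ≤ k, τ j ≠ 0 := fun j hj =>
    ((hX.nonneg k).trans_lt (hlt.trans_le (hY.antitone hj))).ne'
  let L : (Fin (k + 1) → ℝ) →ₗ[ℝ] E := Fintype.linearCombination ℝ fun i : Fin (k + 1) => g' i
  -- The `k` orthogonality constraints on `k + 1` coefficients; a nonzero kernel element is the test
  -- vector.
  let M : (Fin (k + 1) → ℝ) →ₗ[ℝ] (Fin k → ℝ) :=
    LinearMap.pi fun j => (innerₗ E (g j)) ∘ₗ L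
  obtain ⟨c, hc, hc0⟩ := (Submodule.ne_bot_iff _).1
    (LinearMap.ker_ne_bot_of_finrank_lt (f := M) (by simp))
  have hL : L c = ∑ i : Fin (k + 1), c i • g' i := Fintype.linearCombination_apply _ _ _
  have hortho : ∀ i j : Fin (k + 1), ⟪g' i, g' j⟫_ℝ = if i = j then 1 else 0 := fun i j => by
    rw [inner_of_orthonormal_support hY.orthonormal_right (hτ i (Nat.lt_succ_iff.1 i.2))
      (hτ j (Nat.lt_succ_iff.1 j.2))]
    simp [Fin.ext_iff]
  have hcoef : ∀ i : Fin (k + 1), ⟪g' i, L c⟫_ℝ = c i := fun i => by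
    rw [hL, inner_sum]
    simp [inner_smul_right, hortho]
  have hnorm : ‖L c‖ ^ 2 = ∑ i, c i ^ 2 := by
    rw [← real_inner_self_eq_norm_sq]
    nth_rewrite 1 [hL]
    rw [sum_inner]
    exact Finset.sum_congr rfl fun i _ => by rw [inner_smul_left, hcoef, conj_trivial, pow_two]
  have hpos : 0 < ‖L c‖ ^ 2 := by
    rw [hnorm]
    obtain ⟨i, hi⟩ := Function.ne_iff.1 hc0
    exact Finset.sum_pos' (fun _ _ => sq_nonneg _) ⟨i, Finset.mem_univ _, by
      have : c i ≠ 0 := hi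
      positivity⟩
  have hup : ‖X (L c)‖ ≤ σ k * ‖L c‖ := hX.norm_apply_le fun j hj => by
    have h1 := congrFun (LinearMap.mem_ker.1 hc) ⟨j, hj⟩
    exact h1
  have hlow : τ k ^ 2 * ‖L c‖ ^ 2 ≤ ‖Y (L c)‖ ^ 2 := by
    have h1 := sum_le_hasSum (Finset.range (k + 1))
      (fun j _ => mul_nonneg (sq_nonneg _) (sq_nonneg _)) (hY.hasSum_norm_sq_apply (L c))
    refine le_trans ?_ h1
    rw [hnorm, Finset.sum_range, Finset.mul_sum]
    refine Finset.sum_le_sum fun i _ => ?_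
    rw [hcoef]
    have := hY.antitone (Nat.lt_succ_iff.1 i.2)
    have := hY.nonneg k
    gcongr
  have h2 : ‖Y (L c)‖ ^ 2 ≤ σ k ^ 2 * ‖L c‖ ^ 2 := by
    rw [← mul_pow]
    exact pow_le_pow_left₀ (norm_nonneg _) ((h _).trans hup) 2
  have h3 : σ k ^ 2 < τ k ^ 2 := pow_lt_pow_left₀ hlt (hX.nonneg k) two_ne_zero
  nlinarith

theorem unique {f₁ : ℕ → F} (h : IsSVD X σ f g) (h' : IsSVD X τ f₁ g') : σ = τ :=
  funext fun k => le_antisymm (h'.le_of_norm_apply_le h (fun _ => le_rfl) k)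
    (h.le_of_norm_apply_le h' (fun _ => le_rfl) k)

theorem svd_isSVD (h : IsSVD X σ f g) : IsSVD X (svd X).1 (svd X).2.1 (svd X).2.2 := by
  have hex : ∃ p : (ℕ → ℝ) × (ℕ → F) × (ℕ → E), IsSVD X p.1 p.2.1 p.2.2 := ⟨(σ, f, g), h⟩
  unfold svd
  rw [dif_pos hex]
  exact hex.choose_spec

theorem singularValue_eq (h : IsSVD X σ f g) : singularValue X = σ := h.svd_isSVD.unique h

/-- With indices from `0`, `σ r ≠ 0` would put the `r + 1` orthonormal vectors `f 0, …, f r` in the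
range. -/
theorem eq_zero_of_rank_le (h : IsSVD X σ f g) {r : ℕ} (hr : X.toLinearMap.rank ≤ r) :
    σ r = 0 := by
  by_contra hσ
  have hne : ∀ i : Fin (r + 1), σ i ≠ 0 := fun i =>
    ((lt_of_le_of_ne (h.nonneg r) (Ne.symm hσ)).trans_le
      (h.antitone (Nat.lt_succ_iff.1 i.2))).ne'
  have hli : LinearIndependent ℝ (fun i : Fin (r + 1) => f i) :=
    (h.orthonormal_left.comp (fun i : Fin (r + 1) => (⟨i, hne i⟩ : {k // σ k ≠ 0}))
      fun a b hab => by simpa [Fin.ext_iff] using hab).linearIndependent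
  have hmem : ∀ i : Fin (r + 1), f i ∈ LinearMap.range X.toLinearMap := fun i =>
    ⟨(σ i)⁻¹ • g i, by
      change X _ = _
      rw [map_smul, h.apply_right (hne i), smul_smul, inv_mul_cancel₀ (hne i), one_smul]⟩
  have hli' : LinearIndependent ℝ
      (fun i : Fin (r + 1) => (⟨f i, hmem i⟩ : LinearMap.range X.toLinearMap)) :=
    LinearIndependent.of_comp (LinearMap.range X.toLinearMap).subtype hli
  have h1 := hli'.cardinal_lift_le_rank
  have h2 : ((r + 1 : ℕ) : Cardinal) ≤ (r : Cardinal) := by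
    refine le_trans ?_ hr
    simpa using h1
  have h3 := Nat.cast_le.1 h2
  omega

end IsSVD

end Variational

/-! ### Trace and perturbation inequalities -/

section Mirsky

/-- After subtracting `σ m` from `σ`, the terms before `m` are largest for weight one and those from
`m` on are nonpositive. -/
theorem sum_mul_le_sum_range_of_weights {σ w : ℕ → ℝ} (hσ : Antitone σ) (h0 : ∀ k, 0 ≤ σ k)
    (hw0 : ∀ k, 0 ≤ w k) (hw1 : ∀ k, w k ≤ 1) {m N : ℕ} (hw : ∑ k ∈ Finset.range N, w k ≤ m) :
    ∑ k ∈ Finset.range N, σ k * w k ≤ ∑ k ∈ Finset.range m, σ k := by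
  have h1 : ∑ k ∈ Finset.range N, (σ k - σ m) * w k ≤ ∑ k ∈ Finset.range m, (σ k - σ m) := by
    calc ∑ k ∈ Finset.range N, (σ k - σ m) * w k
        ≤ ∑ k ∈ Finset.range N, (if k < m then σ k - σ m else 0) := by
          refine Finset.sum_le_sum fun k _ => ?_
          split_ifs with hk
          · exact mul_le_of_le_one_right (sub_nonneg.2 (hσ hk.le)) (hw1 k)
          · exact mul_nonpos_of_nonpos_of_nonneg (sub_nonpos.2 (hσ (not_lt.1 hk))) (hw0 k)
      _ = ∑ k ∈ (Finset.range N).filter (· < m), (σ k - σ m) := (Finset.sum_filter _ _).symm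
      _ ≤ ∑ k ∈ Finset.range m, (σ k - σ m) := by
          refine Finset.sum_le_sum_of_subset_of_nonneg (fun k hk => ?_) fun k hk _ => ?_
          · simpa using (Finset.mem_filter.1 hk).2
          · exact sub_nonneg.2 (hσ (Finset.mem_range.1 hk).le)
  have h2 : σ m * ∑ k ∈ Finset.range N, w k ≤ σ m * m := mul_le_mul_of_nonneg_left hw (h0 m)
  simp only [sub_mul, Finset.sum_sub_distrib, ← Finset.mul_sum, Finset.sum_const,
    Finset.card_range, nsmul_eq_mul] at h1
  linarith

/-- Abel summation, carried out as an induction on the stronger inequality `key`. -/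
theorem sum_mul_le_sum_mul_of_partial_sums {τ a b : ℕ → ℝ} (hτ : Antitone τ) (h0 : ∀ k, 0 ≤ τ k)
    {r : ℕ} (h : ∀ m ≤ r, ∑ k ∈ Finset.range m, a k ≤ ∑ k ∈ Finset.range m, b k) :
    ∑ k ∈ Finset.range r, τ k * a k ≤ ∑ k ∈ Finset.range r, τ k * b k := by
  have key : ∀ m ≤ r, τ m * (∑ k ∈ Finset.range m, b k - ∑ k ∈ Finset.range m, a k)
      ≤ ∑ k ∈ Finset.range m, τ k * b k - ∑ k ∈ Finset.range m, τ k * a k := by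
    intro m
    induction m with
    | zero => simp
    | succ m ih =>
      intro hm
      have h1 := ih (by omega)
      have h2 := mul_le_mul_of_nonneg_right (hτ (Nat.le_succ m)) (sub_nonneg.2 (h (m + 1) hm))
      simp only [Finset.sum_range_succ, Nat.succ_eq_add_one] at h2 ⊢
      nlinarith
  have h1 := key r le_rfl
  have h2 := mul_nonneg (h0 r) (sub_nonneg.2 (h r le_rfl))
  linarith

variable {E F G : Type*} [NormedAddCommGroup E] [InnerProductSpace ℝ E]
  [NormedAddCommGroup F] [InnerProductSpace ℝ F]
  [NormedAddCommGroup G] [InnerProductSpace ℝ G]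
  {B : F →L[ℝ] E →L[ℝ] G} {u v : G} {σ τ : ℕ → ℝ} {f f' : ℕ → F} {g g' : ℕ → E}

/-- Ky Fan's inequality. Expanding `u` and using `a * b ≤ (a ^ 2 + b ^ 2) / 2` bounds the left side
by a weighted sum of `σ`. Bessel for `x`, `y` keeps each weight below one; Bessel for `f`, `g` keeps
their total below `m`. -/
theorem IsTensorSVD.sum_inner_le (hB : IsTensorPairing B) (h : IsTensorSVD B u σ f g) {m : ℕ}
    {x : Fin m → F} {y : Fin m → E} (hx : Orthonormal ℝ x) (hy : Orthonormal ℝ y) :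
    ∑ l, ⟪B (x l) (y l), u⟫_ℝ ≤ ∑ k ∈ Finset.range m, σ k := by
  have h1 : HasSum (fun k => ∑ l, σ k * (⟪x l, f k⟫_ℝ * ⟪y l, g k⟫_ℝ))
      (∑ l, ⟪B (x l) (y l), u⟫_ℝ) := by
    refine hasSum_sum fun l _ => ?_
    refine ((innerSL ℝ (B (x l) (y l))).hasSum h.hasSum).congr_fun fun k => ?_
    rw [innerSL_apply_apply, inner_smul_right, hB.inner_apply]
  refine le_of_tendsto' h1.tendsto_sum_nat fun N => ?_
  let w : ℕ → ℝ := fun k =>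
    if σ k = 0 then 0 else ∑ l, (⟪x l, f k⟫_ℝ ^ 2 + ⟪y l, g k⟫_ℝ ^ 2) / 2
  have hw0 : ∀ k, 0 ≤ w k := fun k => by
    by_cases hk : σ k = 0
    · simp [w, hk]
    · simp only [w, if_neg hk]
      positivity
  have hw1 : ∀ k, w k ≤ 1 := fun k => by
    by_cases hk : σ k = 0
    · simp [w, hk]
    have h2 := hx.sum_inner_products_le (f k) (s := Finset.univ)
    have h3 := hy.sum_inner_products_le (g k) (s := Finset.univ)
    rw [norm_of_orthonormal_support h.orthonormal_left hk] at h2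
    rw [norm_of_orthonormal_support h.orthonormal_right hk] at h3
    simp only [Real.norm_eq_abs, sq_abs] at h2 h3
    simp only [w, if_neg hk]
    rw [← Finset.sum_div, Finset.sum_add_distrib]
    linarith
  have hw : ∑ k ∈ Finset.range N, w k ≤ m := by
    have h2 : ∀ k, w k = ∑ l, ((if σ k = 0 then 0 else ⟪f k, x l⟫_ℝ ^ 2)
        + (if σ k = 0 then 0 else ⟪g k, y l⟫_ℝ ^ 2)) / 2 := fun k => by
      by_cases hk : σ k = 0
      · simp [w, hk]
      · simp only [w, if_neg hk, real_inner_comm]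
    simp only [h2]
    rw [Finset.sum_comm]
    have h3 : ∀ l ∈ (Finset.univ : Finset (Fin m)), ∑ k ∈ Finset.range N,
        ((if σ k = 0 then 0 else ⟪f k, x l⟫_ℝ ^ 2)
          + (if σ k = 0 then 0 else ⟪g k, y l⟫_ℝ ^ 2)) / 2 ≤ 1 := fun l _ => by
      have h4 := sum_inner_sq_le h.orthonormal_left (Finset.range N) (x l)
      have h5 := sum_inner_sq_le h.orthonormal_right (Finset.range N) (y l)
      rw [hx.1 l] at h4
      rw [hy.1 l] at h5
      rw [← Finset.sum_div, Finset.sum_add_distrib]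
      linarith
    simpa using Finset.sum_le_sum h3
  refine le_trans (Finset.sum_le_sum fun k _ => ?_)
    (sum_mul_le_sum_range_of_weights h.antitone h.nonneg hw0 hw1 hw)
  by_cases hk : σ k = 0
  · simp [hk]
  simp only [w, if_neg hk]
  rw [← Finset.mul_sum]
  refine mul_le_mul_of_nonneg_left (Finset.sum_le_sum fun l _ => ?_) (h.nonneg k)
  linarith [two_mul_le_add_sq ⟪x l, f k⟫_ℝ ⟪y l, g k⟫_ℝ]

/-- Von Neumann's trace inequality and Mirsky's inequality, for a second tensor of finite rank. -/
theorem IsTensorSVD.hasSum_sub_sq_le (hB : IsTensorPairing B) (hu : IsTensorSVD B u σ f g)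
    (hv : IsTensorSVD B v τ f' g') (hτ : ∃ r, τ r = 0) :
    Summable (fun k => (τ k - σ k) ^ 2) ∧ ∑' k, (τ k - σ k) ^ 2 ≤ ‖v - u‖ ^ 2 := by
  classical
  obtain ⟨r, hr0, hr1⟩ : ∃ r, (∀ k, r ≤ k → τ k = 0) ∧ ∀ k < r, τ k ≠ 0 :=
    ⟨Nat.find hτ, fun k hk => le_antisymm ((hv.antitone hk).trans_eq (Nat.find_spec hτ))
      (hv.nonneg k), fun k hk => Nat.find_min hτ hk⟩
  have hvsum : v = ∑ k ∈ Finset.range r, τ k • B (f' k) (g' k) :=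
    hv.hasSum.unique (hasSum_sum_of_ne_finset_zero fun k hk => by
      rw [hr0 k (by simpa using hk), zero_smul])
  -- Ky Fan's inequality for the first `m ≤ r` singular pairs of `v` supplies the partial sums for
  -- Abel summation.
  have htrace : ⟪v, u⟫_ℝ ≤ ∑ k ∈ Finset.range r, τ k * σ k := by
    have h1 : ⟪v, u⟫_ℝ = ∑ k ∈ Finset.range r, τ k * ⟪B (f' k) (g' k), u⟫_ℝ := by
      rw [hvsum, sum_inner]
      simp [inner_smul_left]
    rw [h1]
    refine sum_mul_le_sum_mul_of_partial_sums hv.antitone hv.nonneg fun m hm => ?_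
    rw [Finset.sum_range]
    refine hu.sum_inner_le hB (x := fun l : Fin m => f' l) (y := fun l : Fin m => g' l) ?_ ?_
    · exact hv.orthonormal_left.comp
        (fun i : Fin m => (⟨i, hr1 i (i.2.trans_le hm)⟩ : {k // τ k ≠ 0}))
        fun a b hab => by simpa [Fin.ext_iff] using hab
    · exact hv.orthonormal_right.comp
        (fun i : Fin m => (⟨i, hr1 i (i.2.trans_le hm)⟩ : {k // τ k ≠ 0}))
        fun a b hab => by simpa [Fin.ext_iff] using hab
  have h2 : HasSum (fun k => τ k * σ k) (∑ k ∈ Finset.range r, τ k * σ k) :=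
    hasSum_sum_of_ne_finset_zero fun k hk => by rw [hr0 k (by simpa using hk), zero_mul]
  have h3 := ((hv.hasSum_sq hB).sub (h2.mul_left 2)).add (hu.hasSum_sq hB)
  have h4 : HasSum (fun k => (τ k - σ k) ^ 2)
      (‖v‖ ^ 2 - 2 * ∑ k ∈ Finset.range r, τ k * σ k + ‖u‖ ^ 2) :=
    h3.congr_fun fun k => by ring
  refine ⟨h4.summable, ?_⟩
  rw [h4.tsum_eq, norm_sub_sq_real]
  linarith

end Mirsky

/-! ### Soft thresholding and truncation of tensors -/

section Thresholding

theorem softThr_of_nonneg {α x : ℝ} (hα : 0 ≤ α) (hx : 0 ≤ x) :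
    softThr α x = max (x - α) 0 := by
  rcases hx.eq_or_lt with rfl | hx
  · simp [softThr, hα]
  · rw [softThr, Real.sign_of_pos hx, abs_of_pos hx, one_mul]

theorem softThr_mono {α x y : ℝ} (hα : 0 ≤ α) (hx : 0 ≤ x) (hxy : x ≤ y) :
    softThr α x ≤ softThr α y := by
  rw [softThr_of_nonneg hα hx, softThr_of_nonneg hα (hx.trans hxy)]
  gcongr

theorem softThr_nonneg {α x : ℝ} (hα : 0 ≤ α) (hx : 0 ≤ x) : 0 ≤ softThr α x := by
  rw [softThr_of_nonneg hα hx]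
  exact le_max_right _ _

theorem softThr_le_self {α x : ℝ} (hα : 0 ≤ α) (hx : 0 ≤ x) : softThr α x ≤ x := by
  rw [softThr_of_nonneg hα hx]
  exact max_le (by linarith) hx

theorem softThr_of_le {α x : ℝ} (hα : 0 ≤ α) (hx : 0 ≤ x) (h : x ≤ α) : softThr α x = 0 := by
  rw [softThr_of_nonneg hα hx]
  exact max_eq_right (by linarith)

theorem softThr_of_ge {α x : ℝ} (hα : 0 ≤ α) (h : α ≤ x) : softThr α x = x - α := by
  rw [softThr_of_nonneg hα (hα.trans h)]
  exact max_eq_left (by linarith)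

theorem sub_softThr {α x : ℝ} (hα : 0 ≤ α) (hx : 0 ≤ x) : x - softThr α x = min x α := by
  rcases le_total x α with h | h
  · rw [softThr_of_le hα hx h, min_eq_left h, sub_zero]
  · rw [softThr_of_ge hα h, min_eq_right h, sub_sub_cancel]

variable {E F G : Type*} [NormedAddCommGroup E] [InnerProductSpace ℝ E]
  [NormedAddCommGroup F] [InnerProductSpace ℝ F]
  [NormedAddCommGroup G] [InnerProductSpace ℝ G]
  {B : F →L[ℝ] E →L[ℝ] G} {u v u' v' : G} {σ τ : ℕ → ℝ} {f f' : ℕ → F} {g g' : ℕ → E} {α : ℝ}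

/-- `v` arises from `u` by soft thresholding of the singular values. -/
def IsSoftThr (B : F →L[ℝ] E →L[ℝ] G) (α : ℝ) (u v : G) : Prop :=
  ∃ σ f g, IsTensorSVD B u σ f g ∧ IsTensorSVD B v (fun k => softThr α (σ k)) f g

theorem IsSoftThr.flip (h : IsSoftThr B α u v) : IsSoftThr B.flip α u v := by
  obtain ⟨σ, f, g, hu, hv⟩ := h
  exact ⟨σ, g, f, hu.flip, hv.flip⟩

theorem exists_softThr_eq_zero (hα : 0 < α) (h0 : ∀ k, 0 ≤ σ k)
    (hσ : Filter.Tendsto σ Filter.atTop (nhds 0)) :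
    ∃ r, ∀ k, r ≤ k → softThr α (σ k) = 0 := by
  obtain ⟨r, hr⟩ := Filter.eventually_atTop.1 (hσ.eventually_le_const hα)
  exact ⟨r, fun k hk => softThr_of_le hα.le (h0 k) (hr k hk)⟩

theorem IsTensorSVD.softThr (hB : IsTensorPairing B) (hα : 0 < α) (h : IsTensorSVD B u σ f g) :
    IsTensorSVD B (∑' k, softThr α (σ k) • B (f k) (g k)) (fun k => softThr α (σ k)) f g where
  nonneg k := softThr_nonneg hα.le (h.nonneg k)
  antitone j k hjk := softThr_mono hα.le (h.nonneg k) (h.antitone hjk)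
  orthonormal_left := orthonormal_support_mono
    (fun k hk => softThr_of_le hα.le (h.nonneg k) (hk.trans_le hα.le)) h.orthonormal_left
  orthonormal_right := orthonormal_support_mono
    (fun k hk => softThr_of_le hα.le (h.nonneg k) (hk.trans_le hα.le)) h.orthonormal_right
  hasSum := by
    obtain ⟨r, hr⟩ := exists_softThr_eq_zero hα h.nonneg (h.tendsto_zero hB)
    refine (summable_of_ne_finset_zero (s := Finset.range r) fun k hk => ?_).hasSum
    rw [hr k (by simpa using hk), zero_smul]

/-- The residual keeps the singular vectors, and its singular values are capped at `α`; thus it lies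
in the spectral-norm ball of radius `α`. -/
theorem IsTensorSVD.sub_softThr (hα : 0 < α) (h : IsTensorSVD B u σ f g)
    (h' : IsTensorSVD B v (fun k => HTensor.softThr α (σ k)) f g) :
    IsTensorSVD B (u - v) (fun k => min (σ k) α) f g where
  nonneg k := le_min (h.nonneg k) hα.le
  antitone j k hjk := min_le_min_right α (h.antitone hjk)
  orthonormal_left := orthonormal_support_mono
    (fun k hk => by simp [hk, hα.le]) h.orthonormal_left
  orthonormal_right := orthonormal_support_mono
    (fun k hk => by simp [hk, hα.le]) h.orthonormal_right
  hasSum := (h.hasSum.sub h'.hasSum).congr_fun fun k => by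
    rw [← sub_smul, HTensor.sub_softThr hα.le (h.nonneg k)]

theorem IsTensorSVD.hasSum_softThr_sub_sq (hB : IsTensorPairing B) (hα : 0 < α)
    (h : IsTensorSVD B u σ f g) (h' : IsTensorSVD B v (fun k => HTensor.softThr α (σ k)) f g) :
    HasSum (fun k => (HTensor.softThr α (σ k) - σ k) ^ 2) (‖v - u‖ ^ 2) := by
  rw [norm_sub_rev]
  refine ((h.sub_softThr hα h').hasSum_sq hB).congr_fun fun k => ?_
  rw [← HTensor.sub_softThr hα.le (h.nonneg k)]
  ring

/-- Subgradient property: among tensors of spectral norm at most `α`, the residual `u - v` maximizes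
the pairing with `v`, since it attains `α` on every singular pair where `v` is nonzero. -/
theorem IsTensorSVD.inner_softThr_le (hB : IsTensorPairing B) (hα : 0 < α)
    (h : IsTensorSVD B u σ f g) (h' : IsTensorSVD B v (fun k => HTensor.softThr α (σ k)) f g)
    {z : G} (hz : ∀ x y, ⟪B x y, z⟫_ℝ ≤ α * (‖x‖ * ‖y‖)) : ⟪v, z⟫_ℝ ≤ ⟪v, u - v⟫_ℝ := by
  have key : ∀ w, HasSum (fun k => HTensor.softThr α (σ k) * ⟪B (f k) (g k), w⟫_ℝ) ⟪v, w⟫_ℝ :=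
    fun w => by
      rw [real_inner_comm]
      refine ((innerSL ℝ w).hasSum h'.hasSum).congr_fun fun k => ?_
      rw [innerSL_apply_apply, inner_smul_right, real_inner_comm]
  refine hasSum_le (fun k => ?_) (key z) (key (u - v))
  rcases le_or_gt (σ k) α with hk | hk
  · simp [softThr_of_le hα.le (h.nonneg k) hk]
  have hk0 : σ k ≠ 0 := (hα.trans hk).ne'
  refine mul_le_mul_of_nonneg_left ?_ (softThr_nonneg hα.le (h.nonneg k))
  have h1 : min (σ k) α = α := min_eq_right hk.le
  rw [(h.sub_softThr hα h').inner_eq hB (by rw [h1]; exact hα.ne'), h1]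
  refine (hz _ _).trans_eq ?_
  rw [norm_of_orthonormal_support h.orthonormal_left hk0,
    norm_of_orthonormal_support h.orthonormal_right hk0, one_mul, mul_one]

/-! ### Nonexpansiveness and best low-rank approximation -/

section Complete

variable [CompleteSpace F] [CompleteSpace G]

theorem IsTensorSVD.inner_sub_le (hB : IsTensorPairing B) (hα : 0 < α)
    (h : IsTensorSVD B u σ f g) (h' : IsTensorSVD B v (fun k => HTensor.softThr α (σ k)) f g)
    (x : F) (y : E) : ⟪B x y, u - v⟫_ℝ ≤ α * (‖x‖ * ‖y‖) := by
  have h1 := ((h.sub_softThr hα h').isSVD hB).norm_apply_le (k := 0) (y := y) (by simp)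
  rw [← inner_operatorOfBilin]
  calc _ ≤ ‖x‖ * ‖operatorOfBilin B (u - v) y‖ := real_inner_le_norm _ _
    _ ≤ ‖x‖ * (α * ‖y‖) := by
      gcongr
      exact h1.trans (mul_le_mul_of_nonneg_right (min_le_right _ _) (norm_nonneg _))
    _ = _ := by ring

theorem IsSoftThr.norm_sub_le (hB : IsTensorPairing B) (hα : 0 < α) (h : IsSoftThr B α u v)
    (h' : IsSoftThr B α u' v') : ‖v - v'‖ ≤ ‖u - u'‖ := by
  obtain ⟨σ, f, g, hu, hv⟩ := h
  obtain ⟨σ', f', g', hu', hv'⟩ := h'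
  have h1 := hu.inner_softThr_le hB hα hv (hu'.inner_sub_le hB hα hv')
  have h2 := hu'.inner_softThr_le hB hα hv' (hu.inner_sub_le hB hα hv)
  -- Monotonicity of the subdifferential, from adding the two subgradient inequalities; it gives
  -- firm nonexpansiveness.
  have h3 : 0 ≤ ⟪v - v', (u - v) - (u' - v')⟫_ℝ := by
    rw [inner_sub_right, inner_sub_left, inner_sub_left]
    linarith
  have h4 : ‖u - u'‖ ^ 2 = ‖v - v'‖ ^ 2 + 2 * ⟪v - v', (u - v) - (u' - v')⟫_ℝ
      + ‖(u - v) - (u' - v')‖ ^ 2 := by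
    rw [← norm_add_sq_real]
    congr 2
    abel
  refine le_of_sq_le_sq ?_ (norm_nonneg _)
  rw [h4]
  have h5 := sq_nonneg ‖(u - v) - (u' - v')‖
  linarith

theorem IsTensorPairing.exists_softThr [CompleteSpace E] (hB : IsTensorPairing B) (hα : 0 < α)
    (u : G) : ∃ v, IsSoftThr B α u v ∧ softThrOp α (operatorOfBilin B u) = operatorOfBilin B v := by
  obtain ⟨σ, f, g, h⟩ := hB.exists_isTensorSVD u
  have h1 := (h.isSVD hB).svd_isSVD.isTensorSVD hB
  have h2 := h1.softThr hB hα
  exact ⟨_, ⟨_, _, _, h1, h2⟩, (h2.isSVD hB).hasSum.tsum_eq⟩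

/-- The lower half of Eckart–Young: in Mirsky's inequality the singular values of `v` vanish from
index `r` on. -/
theorem IsTensorSVD.tsum_tail_le_norm_sub_sq [CompleteSpace E] (hB : IsTensorPairing B)
    (h : IsTensorSVD B u σ f g) {r : ℕ} (hr : (operatorOfBilin B v).toLinearMap.rank ≤ r) :
    ∑' k, σ (r + k) ^ 2 ≤ ‖u - v‖ ^ 2 := by
  obtain ⟨τ, f', g', h'⟩ := hB.exists_isTensorSVD v
  have hτ0 := (h'.isSVD hB).eq_zero_of_rank_le hr
  have hτ : ∀ k, τ (r + k) = 0 := fun k =>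
    le_antisymm ((h'.antitone (Nat.le_add_right r k)).trans_eq hτ0) (h'.nonneg _)
  obtain ⟨h1, h2⟩ := h.hasSum_sub_sq_le hB h' ⟨r, hτ0⟩
  rw [norm_sub_rev]
  refine le_trans ?_ h2
  rw [← h1.sum_add_tsum_nat_add r]
  refine le_add_of_nonneg_of_le (Finset.sum_nonneg fun _ _ => sq_nonneg _) (le_of_eq ?_)
  refine tsum_congr fun k => ?_
  rw [add_comm k r, hτ, zero_sub, neg_sq]

theorem IsTensorSVD.exists_truncation (hB : IsTensorPairing B) (h : IsTensorSVD B u σ f g)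
    (r : ℕ) : ∃ w, (operatorOfBilin B w).toLinearMap.rank ≤ r ∧
      ‖u - w‖ ^ 2 = ∑' k, σ (r + k) ^ 2 := by
  let w := ∑ k ∈ Finset.range r, σ k • B (f k) (g k)
  have hM : ∀ y, operatorOfBilin B w y = ∑ k ∈ Finset.range r, (σ k * ⟪g k, y⟫_ℝ) • f k := by
    intro y
    have h1 : operatorOfBilin B w = ∑ k ∈ Finset.range r,
        σ k • InnerProductSpace.rankOne ℝ (f k) (g k) := by
      rw [← operatorOfBilinL_apply, map_sum]
      exact Finset.sum_congr rfl fun k _ => by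
        rw [map_smul, operatorOfBilinL_apply, hB.operatorOfBilin_apply_apply]
    rw [h1]
    simp [sum_apply, mul_smul]
  refine ⟨w, ?_, ?_⟩
  · classical
    have h1 : LinearMap.range (operatorOfBilin B w).toLinearMap
        ≤ Submodule.span ℝ (((Finset.range r).image f : Finset F) : Set F) := by
      rintro _ ⟨y, rfl⟩
      change operatorOfBilin B w y ∈ _
      rw [hM]
      refine Submodule.sum_mem _ fun k hk => Submodule.smul_mem _ _ (Submodule.subset_span ?_)
      exact Finset.mem_coe.2 (Finset.mem_image_of_mem f hk)
    refine (Submodule.rank_mono h1).trans ((rank_span_finset_le _).trans ?_)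
    exact_mod_cast Finset.card_image_le.trans_eq (Finset.card_range r)
  · have hinner : ∀ z, ⟪w, z⟫_ℝ = ∑ k ∈ Finset.range r, σ k * ⟪B (f k) (g k), z⟫_ℝ := fun z => by
      simp [w, sum_inner, inner_smul_left]
    have hu : ⟪w, u⟫_ℝ = ∑ k ∈ Finset.range r, σ k ^ 2 := by
      rw [hinner]
      refine Finset.sum_congr rfl fun k _ => ?_
      by_cases hk : σ k = 0
      · simp [hk]
      · rw [h.inner_eq hB hk, pow_two]
    have hw : ‖w‖ ^ 2 = ∑ k ∈ Finset.range r, σ k ^ 2 := by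
      rw [← real_inner_self_eq_norm_sq, hinner]
      refine Finset.sum_congr rfl fun k hk => ?_
      by_cases hk0 : σ k = 0
      · simp [hk0]
      have ho := hB.orthonormal h.orthonormal_left h.orthonormal_right
      rw [real_inner_comm, hinner, Finset.sum_eq_single_of_mem k hk, real_inner_self_eq_norm_sq,
        norm_of_orthonormal_support (f := fun k => B (f k) (g k)) ho hk0]
      · ring
      · intro j _ hj
        by_cases hj0 : σ j = 0
        · simp [hj0]
        · rw [inner_of_orthonormal_support (f := fun k => B (f k) (g k)) ho hj0 hk0, if_neg hj,
            mul_zero]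
    have h1 := h.hasSum_sq hB
    rw [norm_sub_sq_real, real_inner_comm, hu, hw, ← h1.tsum_eq,
      ← h1.summable.sum_add_tsum_nat_add r]
    simp only [add_comm r]
    ring

end Complete

/-! ### The number of singular values above a threshold -/

theorem isGreatest_sSup_threshold {σ : ℕ → ℝ} {δ : ℝ} (hδ : 0 < δ)
    (hσ : Filter.Tendsto σ Filter.atTop (nhds 0)) :
    IsGreatest ({r : ℕ | 1 ≤ r ∧ δ < σ (r - 1)} ∪ {0})
      (sSup ({r : ℕ | 1 ≤ r ∧ δ < σ (r - 1)} ∪ {0})) := by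
  obtain ⟨r, hr⟩ := Filter.eventually_atTop.1 (hσ.eventually_le_const hδ)
  have hbdd : BddAbove ({r : ℕ | 1 ≤ r ∧ δ < σ (r - 1)} ∪ {0}) := by
    refine ⟨r, ?_⟩
    rintro k (⟨hk1, hk⟩ | hk)
    · by_contra! hlt
      exact absurd (hr (k - 1) (by omega)) (not_le.2 hk)
    · rw [Set.mem_singleton_iff.1 hk]
      exact Nat.zero_le r
  exact ⟨Nat.sSup_mem ⟨0, Or.inr rfl⟩ hbdd, fun k hk => le_csSup hbdd hk⟩

/-- The shift between ranks counted from `1` and indices from `0` makes the inequality `k < R`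
strict; `R = 0` covers the case of no value above `δ`. -/
theorem lt_iff_lt_of_isGreatest_threshold {σ : ℕ → ℝ} {δ : ℝ} (hσ : Antitone σ) {R : ℕ}
    (hR : IsGreatest ({r : ℕ | 1 ≤ r ∧ δ < σ (r - 1)} ∪ {0}) R) (k : ℕ) : δ < σ k ↔ k < R := by
  constructor
  · intro hk
    exact hR.2 (Or.inl ⟨Nat.succ_pos k, by simpa using hk⟩)
  · intro hk
    rcases hR.1 with ⟨_, hδ⟩ | h0
    · exact hδ.trans_le (hσ (by omega))
    · rw [Set.mem_singleton_iff.1 h0] at hk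
      omega

theorem tsum_softThr_sub_sq {σ : ℕ → ℝ} {α : ℝ} (hα : 0 < α) (h0 : ∀ k, 0 ≤ σ k) {R : ℕ}
    (hR : ∀ k, α < σ k ↔ k < R) (hs : Summable fun k => (softThr α (σ k) - σ k) ^ 2) :
    ∑' k, (softThr α (σ k) - σ k) ^ 2 = α ^ 2 * R + ∑' k, σ (R + k) ^ 2 := by
  rw [← hs.sum_add_tsum_nat_add R]
  congr 1
  · rw [Finset.sum_congr rfl (g := fun _ => α ^ 2), Finset.sum_const, Finset.card_range,
      nsmul_eq_mul, mul_comm]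
    intro k hk
    rw [softThr_of_ge hα.le ((hR k).2 (Finset.mem_range.1 hk)).le]
    ring
  · refine tsum_congr fun k => ?_
    rw [add_comm k R, softThr_of_le hα.le (h0 _)
      (not_lt.1 fun h => absurd ((hR _).1 h) (by omega)), zero_sub, neg_sq]

end Thresholding

/-! ### The tensor pairing of complementary sets of modes -/

section HilbertTensorExt

/-- The real inner product as a continuous bilinear map. -/
def realInnerSL (V : Type*) [NormedAddCommGroup V] [InnerProductSpace ℝ V] :
    V →L[ℝ] V →L[ℝ] ℝ := innerSL ℝ

theorem realInnerSL_apply {V : Type*} [NormedAddCommGroup V] [InnerProductSpace ℝ V] (x y : V) :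
    realInnerSL V x y = ⟪x, y⟫_ℝ := rfl

variable {ι : Type*} [Fintype ι] {H : ι → Type*}
  [∀ i, NormedAddCommGroup (H i)] [∀ i, InnerProductSpace ℝ (H i)]

/-- The elementary tensor of the vectors `x i` in the Hilbert space tensor product. -/
def elemTensor (x : ∀ i, H i) : HilbertTensor H := (algPure x : AlgTensor H)

theorem inner_elemTensor (x y : ∀ i, H i) :
    ⟪elemTensor x, elemTensor y⟫_ℝ = ∏ i, ⟪x i, y i⟫_ℝ := by
  unfold elemTensor
  rw [UniformSpace.Completion.inner_coe, inner_algPure]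

theorem ext_elemTensor {V : Type*} [NormedAddCommGroup V] [NormedSpace ℝ V]
    {L L' : HilbertTensor H →L[ℝ] V} (h : ∀ x, L (elemTensor x) = L' (elemTensor x)) : L = L' := by
  ext u
  induction u using UniformSpace.Completion.induction_on with
  | hp => exact isClosed_eq L.continuous L'.continuous
  | ih a =>
    induction a using algTensor_induction with
    | smul c x =>
      rw [UniformSpace.Completion.coe_smul, map_smul, map_smul]
      exact congrArg (c • ·) (h x)
    | add u v hu hv => rw [UniformSpace.Completion.coe_add, map_add, map_add, hu, hv]

theorem ext_inner_elemTensor {u v : HilbertTensor H}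
    (h : ∀ x, ⟪elemTensor x, u⟫_ℝ = ⟪elemTensor x, v⟫_ℝ) :
    u = v := by
  have h1 : innerSL ℝ u = innerSL ℝ v := ext_elemTensor fun x => by
    rw [innerSL_apply_apply, innerSL_apply_apply, real_inner_comm, h, real_inner_comm]
  refine ext_inner_right ℝ fun w => ?_
  rw [← innerSL_apply_apply, h1, innerSL_apply_apply]

end HilbertTensorExt

theorem glue_restrict {ι : Type*} [DecidableEq ι] {H : ι → Type*} [∀ i, NormedAddCommGroup (H i)]
    (n : Finset ι) (w : ∀ i, H i) : glue n (fun i => w i) (fun i => w i) = w := by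
  ext i
  by_cases h : i ∈ n <;> simp [glue, h]

theorem prod_glue {ι : Type*} [Fintype ι] [DecidableEq ι] {H : ι → Type*}
    [∀ i, NormedAddCommGroup (H i)] (n : Finset ι) (c : ∀ i, H i → H i → ℝ)
    (x x' : ∀ i : {i // i ∈ n}, H i)
    (y y' : ∀ i : {i // i ∉ n}, H i) : ∏ i, c i (glue n x y i) (glue n x' y' i)
      = (∏ i : {i // i ∈ n}, c i (x i) (x' i)) * ∏ i : {i // i ∉ n}, c i (y i) (y' i) := by
  rw [← (Equiv.sumCompl (· ∈ n)).prod_comp, Fintype.prod_sum_type]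
  congr 1
  · refine Finset.prod_congr rfl fun i _ => ?_
    obtain ⟨i, hi⟩ := i
    simp [glue, hi]
  · refine Finset.prod_congr rfl fun i _ => ?_
    obtain ⟨i, hi⟩ := i
    simp [glue, hi]

/-! ### Product maps and bilinear forms that factor over modes -/

section TensorMul

variable {ι : Type*} [Fintype ι] [DecidableEq ι] {H : ι → Type*}
  [∀ i, NormedAddCommGroup (H i)] [∀ i, InnerProductSpace ℝ (H i)]

theorem tensorMul_elemTensor (n : Finset ι) (x : ∀ i : {i // i ∈ n}, H i)
    (y : ∀ i : {i // i ∉ n}, H i) :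
    tensorMul H n (elemTensor x) (elemTensor y) = elemTensor (glue n x y) := by
  unfold elemTensor
  rw [tensorMul_coe, algMul_algPure]

theorem inner_tensorMul (n : Finset ι) (x x' : ModeTensor H n) (y y' : CoModeTensor H n) :
    ⟪tensorMul H n x y, tensorMul H n x' y'⟫_ℝ = ⟪x, x'⟫_ℝ * ⟪y, y'⟫_ℝ := by
  have h1 : ∀ y y' : (∀ i : {i // i ∉ n}, H i),
      (realInnerSL _).bilinearComp ((tensorMul H n).flip (elemTensor y))
          ((tensorMul H n).flip (elemTensor y'))
        = ⟪elemTensor y, elemTensor y'⟫_ℝ • realInnerSL _ := fun y y' => by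
    refine ext_elemTensor fun x => ext_elemTensor fun x' => ?_
    simp only [ContinuousLinearMap.bilinearComp_apply, ContinuousLinearMap.flip_apply,
      realInnerSL_apply, smul_apply, smul_eq_mul, tensorMul_elemTensor, inner_elemTensor]
    rw [prod_glue n (fun i a b => ⟪a, b⟫_ℝ), mul_comm]
  have h2 : (realInnerSL _).bilinearComp (tensorMul H n x) (tensorMul H n x')
      = ⟪x, x'⟫_ℝ • realInnerSL _ := by
    refine ext_elemTensor fun y => ext_elemTensor fun y' => ?_
    have h3 := DFunLike.congr_fun (DFunLike.congr_fun (h1 y y') x) x'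
    simpa only [ContinuousLinearMap.bilinearComp_apply, ContinuousLinearMap.flip_apply,
      realInnerSL_apply, smul_apply, smul_eq_mul, mul_comm] using h3
  exact DFunLike.congr_fun (DFunLike.congr_fun h2 y) y'

theorem isTensorPairing_tensorMul (n : Finset ι) : IsTensorPairing (tensorMul H n) where
  inner_apply x y x' y' := inner_tensorMul n x x' y y'
  eq_zero u h := by
    refine ext_inner_elemTensor fun w => ?_
    rw [inner_zero_right, ← glue_restrict n w, ← tensorMul_elemTensor]
    exact h _ _

/-- For elementary `y`, `y'` the form is a multiple of `⟪x, x'⟫` by density in `x` and `x'`. With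
`x`, `x'` orthogonal it vanishes there, and density in `y`, `y'` finishes. Only the factors over `n`
have to be inner products. -/
theorem inner_tensorMul_eq_zero_left (n : Finset ι)
    (Q : HilbertTensor H →L[ℝ] HilbertTensor H →L[ℝ] ℝ) (c : ∀ i, H i → H i → ℝ)
    (hQ : ∀ w w', Q (elemTensor w) (elemTensor w') = ∏ i, c i (w i) (w' i))
    (hc : ∀ i ∈ n, ∀ a b, c i a b = ⟪a, b⟫_ℝ) {x x' : ModeTensor H n} (hx : ⟪x, x'⟫_ℝ = 0)
    (y y' : CoModeTensor H n) : Q (tensorMul H n x y) (tensorMul H n x' y') = 0 := by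
  have h1 : ∀ y y' : (∀ i : {i // i ∉ n}, H i),
      Q.bilinearComp ((tensorMul H n).flip (elemTensor y)) ((tensorMul H n).flip (elemTensor y'))
        = (∏ i : {i // i ∉ n}, c i (y i) (y' i)) • realInnerSL _ := fun y y' => by
    refine ext_elemTensor fun x => ext_elemTensor fun x' => ?_
    simp only [ContinuousLinearMap.bilinearComp_apply, ContinuousLinearMap.flip_apply,
      realInnerSL_apply, smul_apply, smul_eq_mul, tensorMul_elemTensor, inner_elemTensor, hQ]
    rw [prod_glue n c, mul_comm]
    congr 1
    exact Finset.prod_congr rfl fun i _ => hc i i.2 _ _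
  have h2 : Q.bilinearComp (tensorMul H n x) (tensorMul H n x') = 0 := by
    refine ext_elemTensor fun y => ext_elemTensor fun y' => ?_
    have h3 := DFunLike.congr_fun (DFunLike.congr_fun (h1 y y') x) x'
    simp only [ContinuousLinearMap.bilinearComp_apply, ContinuousLinearMap.flip_apply,
      realInnerSL_apply, smul_apply, smul_eq_mul, hx, mul_zero] at h3
    exact h3
  exact DFunLike.congr_fun (DFunLike.congr_fun h2 y) y'

theorem inner_tensorMul_eq_zero_right (n : Finset ι)
    (Q : HilbertTensor H →L[ℝ] HilbertTensor H →L[ℝ] ℝ) (c : ∀ i, H i → H i → ℝ)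
    (hQ : ∀ w w', Q (elemTensor w) (elemTensor w') = ∏ i, c i (w i) (w' i))
    (hc : ∀ i ∉ n, ∀ a b, c i a b = ⟪a, b⟫_ℝ) {y y' : CoModeTensor H n} (hy : ⟪y, y'⟫_ℝ = 0)
    (x x' : ModeTensor H n) : Q (tensorMul H n x y) (tensorMul H n x' y') = 0 := by
  have h1 : ∀ x x' : (∀ i : {i // i ∈ n}, H i),
      Q.bilinearComp (tensorMul H n (elemTensor x)) (tensorMul H n (elemTensor x'))
        = (∏ i : {i // i ∈ n}, c i (x i) (x' i)) • realInnerSL _ := fun x x' => by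
    refine ext_elemTensor fun y => ext_elemTensor fun y' => ?_
    simp only [ContinuousLinearMap.bilinearComp_apply,
      realInnerSL_apply, smul_apply, smul_eq_mul, tensorMul_elemTensor, inner_elemTensor, hQ]
    rw [prod_glue n c]
    congr 1
    exact Finset.prod_congr rfl fun i _ => hc i i.2 _ _
  have h2 : Q.bilinearComp ((tensorMul H n).flip y) ((tensorMul H n).flip y') = 0 := by
    refine ext_elemTensor fun x => ext_elemTensor fun x' => ?_
    have h3 := DFunLike.congr_fun (DFunLike.congr_fun (h1 x x') y) y'
    simp only [ContinuousLinearMap.bilinearComp_apply,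
      realInnerSL_apply, smul_apply, smul_eq_mul, hy, mul_zero] at h3
    exact h3
  exact DFunLike.congr_fun (DFunLike.congr_fun h2 x) x'

theorem matricization_elemTensor (n : Finset ι) (w : ∀ i, H i) (y : ∀ i : {i // i ∉ n}, H i) :
    matricization n (elemTensor w) (elemTensor y)
      = (∏ i : {i // i ∉ n}, ⟪w i, y i⟫_ℝ) • elemTensor (fun i : {i // i ∈ n} => w i) := by
  refine ext_inner_elemTensor fun x => ?_
  rw [inner_matricization, tensorMul_elemTensor, ← glue_restrict n w, inner_elemTensor,
    prod_glue n (fun i a b => ⟪a, b⟫_ℝ), inner_smul_right, inner_elemTensor, mul_comm]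
  simp only [glue_restrict, real_inner_comm]

theorem flip_matricization_elemTensor (n : Finset ι) (w : ∀ i, H i)
    (x : ∀ i : {i // i ∈ n}, H i) :
    operatorOfBilin (tensorMul H n).flip (elemTensor w) (elemTensor x)
      = (∏ i : {i // i ∈ n}, ⟪w i, x i⟫_ℝ) • elemTensor (fun i : {i // i ∉ n} => w i) := by
  refine ext_inner_elemTensor fun y => ?_
  rw [inner_operatorOfBilin, ContinuousLinearMap.flip_apply, tensorMul_elemTensor,
    ← glue_restrict n w,
    inner_elemTensor, prod_glue n (fun i a b => ⟪a, b⟫_ℝ), inner_smul_right, inner_elemTensor]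
  simp only [glue_restrict, real_inner_comm]

/-- The bilinear forms arising from matricizations factor on elementary tensors. -/
theorem inner_matricization_elemTensor (n : Finset ι) (w w' : ∀ i, H i)
    (y y' : ∀ i : {i // i ∉ n}, H i) :
    ⟪matricization n (elemTensor w) (elemTensor y), matricization n (elemTensor w') (elemTensor y')⟫_ℝ
      = ∏ i, (if h : i ∈ n then ⟪w i, w' i⟫_ℝ else ⟪w i, y ⟨i, h⟩⟫_ℝ * ⟪w' i, y' ⟨i, h⟩⟫_ℝ) := by
  have h1 := prod_glue n (fun i (a b : H i) => if h : i ∈ n then ⟪a, b⟫_ℝ else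
    ⟪a, y ⟨i, h⟩⟫_ℝ * ⟪b, y' ⟨i, h⟩⟫_ℝ) (fun i => w i) (fun i => w' i) (fun i => w i)
    (fun i => w' i)
  rw [glue_restrict, glue_restrict] at h1
  rw [h1, matricization_elemTensor, matricization_elemTensor, inner_smul_left, inner_smul_right,
    inner_elemTensor, conj_trivial, ← mul_assoc, ← Finset.prod_mul_distrib, mul_comm]
  congr 1
  · exact Finset.prod_congr rfl fun i _ => by rw [dif_pos i.2]
  · exact Finset.prod_congr rfl fun i _ => by rw [dif_neg i.2]

theorem inner_flip_matricization_elemTensor (n : Finset ι) (w w' : ∀ i, H i)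
    (x x' : ∀ i : {i // i ∈ n}, H i) :
    ⟪operatorOfBilin (tensorMul H n).flip (elemTensor w) (elemTensor x),
      operatorOfBilin (tensorMul H n).flip (elemTensor w') (elemTensor x')⟫_ℝ
      = ∏ i, (if h : i ∈ n then ⟪w i, x ⟨i, h⟩⟫_ℝ * ⟪w' i, x' ⟨i, h⟩⟫_ℝ else ⟪w i, w' i⟫_ℝ) := by
  have h1 := prod_glue n (fun i (a b : H i) => if h : i ∈ n then
    ⟪a, x ⟨i, h⟩⟫_ℝ * ⟪b, x' ⟨i, h⟩⟫_ℝ else ⟪a, b⟫_ℝ) (fun i => w i) (fun i => w' i)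
    (fun i => w i) (fun i => w' i)
  rw [glue_restrict, glue_restrict] at h1
  rw [h1, flip_matricization_elemTensor, flip_matricization_elemTensor, inner_smul_left,
    inner_smul_right, inner_elemTensor, conj_trivial, ← mul_assoc, ← Finset.prod_mul_distrib]
  congr 1
  · exact Finset.prod_congr rfl fun i _ => by rw [dif_pos i.2]
  · exact Finset.prod_congr rfl fun i _ => by rw [dif_neg i.2]

end TensorMul

/-! ### Soft thresholding along one edge and singular values along another edge -/

/-- The images of the singular components stay orthogonal under `L`, so by Pythagoras both squared
norms are sums with the same weights, and thresholding lowers each coefficient. -/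
theorem IsSoftThr.norm_map_le {E F G V : Type*} [NormedAddCommGroup E] [InnerProductSpace ℝ E]
    [NormedAddCommGroup F] [InnerProductSpace ℝ F] [NormedAddCommGroup G] [InnerProductSpace ℝ G]
    [NormedAddCommGroup V] [InnerProductSpace ℝ V] {B : F →L[ℝ] E →L[ℝ] G} {u v : G} {α : ℝ}
    (hα : 0 ≤ α) (h : IsSoftThr B α u v) (L : G →L[ℝ] V)
    (hL : ∀ x x' y y', ⟪x, x'⟫_ℝ = 0 → ⟪L (B x y), L (B x' y')⟫_ℝ = 0) : ‖L v‖ ≤ ‖L u‖ := by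
  obtain ⟨σ, f, g, hu, hv⟩ := h
  have key : ∀ {w : G} {τ : ℕ → ℝ}, IsTensorSVD B w τ f g →
      HasSum (fun k => τ k ^ 2 * ‖L (B (f k) (g k))‖ ^ 2) (‖L w‖ ^ 2) := fun {w τ} hw => by
    refine (hasSum_norm_sq_of_pairwise_inner_eq_zero (L.hasSum hw.hasSum)
      fun j k hjk => ?_).congr_fun fun k => ?_
    · by_cases hj : τ j = 0
      · simp [hj]
      by_cases hk : τ k = 0
      · simp [hk]
      rw [map_smul, map_smul, inner_smul_left, inner_smul_right, hL, mul_zero, mul_zero]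
      rw [inner_of_orthonormal_support hw.orthonormal_left hj hk, if_neg hjk]
    · rw [map_smul, norm_smul, mul_pow, Real.norm_eq_abs, sq_abs]
  refine le_of_sq_le_sq (hasSum_le (fun k => ?_) (key hv) (key hu)) (norm_nonneg _)
  have h1 := softThr_le_self hα (hu.nonneg k)
  have h2 := softThr_nonneg hα (hu.nonneg k)
  gcongr

section Edges

variable {ι : Type*} [Fintype ι] [DecidableEq ι] {H : ι → Type*}
  [∀ i, NormedAddCommGroup (H i)] [∀ i, InnerProductSpace ℝ (H i)]
  {u v : HilbertTensor H} {α : ℝ} {n m : Finset ι}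

theorem inner_eq_zero_of_elemTensor {κ : Type*} [Fintype κ] {K : κ → Type*}
    [∀ i, NormedAddCommGroup (K i)] [∀ i, InnerProductSpace ℝ (K i)] {V : Type*}
    [NormedAddCommGroup V] [InnerProductSpace ℝ V] {A A' : HilbertTensor K →L[ℝ] V}
    (h : ∀ y y', ⟪A (elemTensor y), A' (elemTensor y')⟫_ℝ = 0) (y y' : HilbertTensor K) :
    ⟪A y, A' y'⟫_ℝ = 0 := by
  have h1 : (realInnerSL V).bilinearComp A A' = 0 :=
    ext_elemTensor fun y => ext_elemTensor fun y' => h y y'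
  exact DFunLike.congr_fun (DFunLike.congr_fun h1 y) y'

/-- Modes in `m` are not contracted by the matricization, so orthogonality of the singular vectors
carried by `n` or `nᶜ` is preserved when that set lies in `m`. -/
theorem IsSoftThr.norm_matricization_le (hα : 0 ≤ α) (h : IsSoftThr (tensorMul H n) α u v)
    (hnm : n ⊆ m ∨ nᶜ ⊆ m) (y : CoModeTensor H m) :
    ‖matricization m v y‖ ≤ ‖matricization m u y‖ := by
  let L : CoModeTensor H m → HilbertTensor H →L[ℝ] ModeTensor H m :=
    fun y => (operatorOfBilinL (tensorMul H m)).flip y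
  let Q : CoModeTensor H m → CoModeTensor H m →
    HilbertTensor H →L[ℝ] HilbertTensor H →L[ℝ] ℝ :=
    fun y y' => (realInnerSL _).bilinearComp (L y) (L y')
  have hQ : ∀ (y y' : ∀ i : {i // i ∉ m}, H i) (w w' : ∀ i, H i),
      Q (elemTensor y) (elemTensor y') (elemTensor w) (elemTensor w') = _ :=
    fun y y' w w' => inner_matricization_elemTensor m w w' y y'
  rcases hnm with hnm | hnm
  · refine h.norm_map_le hα (L y) fun x x' z z' hx => ?_
    -- The two arguments are freed before reducing to elementary tensors: the density argument needs
    -- the bilinear form, not its diagonal.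
    refine inner_eq_zero_of_elemTensor (A := matricization m (tensorMul H n x z))
      (A' := matricization m (tensorMul H n x' z')) (fun y y' => ?_) y y
    refine inner_tensorMul_eq_zero_left n (Q (elemTensor y) (elemTensor y'))
      (fun i a b => if h : i ∈ m then ⟪a, b⟫_ℝ else ⟪a, y ⟨i, h⟩⟫_ℝ * ⟪b, y' ⟨i, h⟩⟫_ℝ)
      (hQ y y') (fun i hi a b => dif_pos (hnm hi)) hx z z'
  · refine h.flip.norm_map_le hα (L y) fun z z' x x' hz => ?_
    refine inner_eq_zero_of_elemTensor (A := matricization m (tensorMul H n x z))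
      (A' := matricization m (tensorMul H n x' z')) (fun y y' => ?_) y y
    refine inner_tensorMul_eq_zero_right n (Q (elemTensor y) (elemTensor y'))
      (fun i a b => if h : i ∈ m then ⟪a, b⟫_ℝ else ⟪a, y ⟨i, h⟩⟫_ℝ * ⟪b, y' ⟨i, h⟩⟫_ℝ)
      (hQ y y') (fun i hi a b => dif_pos (hnm (Finset.mem_compl.2 hi))) hz x x'

theorem IsSoftThr.norm_flip_matricization_le (hα : 0 ≤ α)
    (h : IsSoftThr (tensorMul H n) α u v) (hnm : Disjoint n m ∨ m ⊆ n) (x : ModeTensor H m) :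
    ‖operatorOfBilin (tensorMul H m).flip v x‖ ≤ ‖operatorOfBilin (tensorMul H m).flip u x‖ := by
  let L : ModeTensor H m → HilbertTensor H →L[ℝ] CoModeTensor H m :=
    fun x => (operatorOfBilinL (tensorMul H m).flip).flip x
  let Q : ModeTensor H m → ModeTensor H m →
    HilbertTensor H →L[ℝ] HilbertTensor H →L[ℝ] ℝ :=
    fun x x' => (realInnerSL _).bilinearComp (L x) (L x')
  have hQ : ∀ (x x' : ∀ i : {i // i ∈ m}, H i) (w w' : ∀ i, H i),
      Q (elemTensor x) (elemTensor x') (elemTensor w) (elemTensor w') = _ :=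
    fun x x' w w' => inner_flip_matricization_elemTensor m w w' x x'
  rcases hnm with hnm | hnm
  · refine h.norm_map_le hα (L x) fun y y' z z' hy => ?_
    refine inner_eq_zero_of_elemTensor
      (A := operatorOfBilin (tensorMul H m).flip (tensorMul H n y z))
      (A' := operatorOfBilin (tensorMul H m).flip (tensorMul H n y' z')) (fun x x' => ?_) x x
    refine inner_tensorMul_eq_zero_left n (Q (elemTensor x) (elemTensor x'))
      (fun i a b => if h : i ∈ m then ⟪a, x ⟨i, h⟩⟫_ℝ * ⟪b, x' ⟨i, h⟩⟫_ℝ else ⟪a, b⟫_ℝ)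
      (hQ x x') (fun i hi a b => dif_neg (Finset.disjoint_left.1 hnm hi)) hy z z'
  · refine h.flip.norm_map_le hα (L x) fun z z' y y' hz => ?_
    refine inner_eq_zero_of_elemTensor
      (A := operatorOfBilin (tensorMul H m).flip (tensorMul H n y z))
      (A' := operatorOfBilin (tensorMul H m).flip (tensorMul H n y' z')) (fun x x' => ?_) x x
    refine inner_tensorMul_eq_zero_right n (Q (elemTensor x) (elemTensor x'))
      (fun i a b => if h : i ∈ m then ⟪a, x ⟨i, h⟩⟫_ℝ * ⟪b, x' ⟨i, h⟩⟫_ℝ else ⟪a, b⟫_ℝ)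
      (hQ x x') (fun i hi a b => dif_neg fun h => hi (hnm h)) hz y y'

theorem hsv_eq {σ : ℕ → ℝ} {f : ℕ → ModeTensor H n} {g : ℕ → CoModeTensor H n}
    (h : IsTensorSVD (tensorMul H n) u σ f g) : hsv n u = σ :=
  (h.isSVD (isTensorPairing_tensorMul n)).singularValue_eq

theorem exists_isTensorSVD_hsv (n : Finset ι) (u : HilbertTensor H) :
    ∃ f g, IsTensorSVD (tensorMul H n) u (hsv n u) f g := by
  obtain ⟨σ, f, g, h⟩ := (isTensorPairing_tensorMul n).exists_isTensorSVD u
  rw [hsv_eq h]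
  exact ⟨f, g, h⟩

/-- The edges `{n, nᶜ}` and `{m, mᶜ}` do not cross. -/
def NonCrossing (n m : Finset ι) : Prop := (n ⊆ m ∨ nᶜ ⊆ m) ∨ (Disjoint n m ∨ m ⊆ n)

/-- The matricization serves when a side of the first edge lies in `m`, its transpose when one lies
in `mᶜ`; both have the same singular values. -/
theorem IsSoftThr.hsv_le (hα : 0 ≤ α) (h : IsSoftThr (tensorMul H n) α u v)
    (hnm : NonCrossing n m) (k : ℕ) : hsv m v k ≤ hsv m u k := by
  obtain ⟨f, g, hu⟩ := exists_isTensorSVD_hsv m u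
  obtain ⟨f', g', hv⟩ := exists_isTensorSVD_hsv m v
  have hB := isTensorPairing_tensorMul (H := H) m
  rcases hnm with hnm | hnm
  · exact (hu.isSVD hB).le_of_norm_apply_le (hv.isSVD hB) (h.norm_matricization_le hα hnm) k
  · exact (hu.flip.isSVD hB.flip).le_of_norm_apply_le (hv.flip.isSVD hB.flip)
      (h.norm_flip_matricization_le hα hnm) k

theorem isSoftThr_softThrMode (hα : 0 < α) (n : Finset ι) (u : HilbertTensor H) :
    IsSoftThr (tensorMul H n) α u (softThrMode n α u) := by
  obtain ⟨v, hv, he⟩ := (isTensorPairing_tensorMul n).exists_softThr hα u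
  have h1 : softThrMode n α u = v := by
    unfold softThrMode tensorize
    have h2 : softThrOp α (matricization n u) = matricization n v := he
    rw [h2]
    -- The thresholded operator is itself a matricization, so `invFun` returns its unique preimage.
    exact Function.leftInverse_invFun
      (isTensorPairing_tensorMul n).operatorOfBilin_injective v
  rwa [h1]

theorem hsv_softThrMode (hα : 0 < α) (n : Finset ι) (u : HilbertTensor H) (k : ℕ) :
    hsv n (softThrMode n α u) k = softThr α (hsv n u k) := by
  obtain ⟨σ, f, g, hu, hv⟩ := isSoftThr_softThrMode hα n u
  rw [hsv_eq hu, hsv_eq hv]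

theorem hasSum_hsv_softThrMode_sub_sq (hα : 0 < α) (n : Finset ι) (u : HilbertTensor H) :
    HasSum (fun k => (hsv n (softThrMode n α u) k - hsv n u k) ^ 2)
      (‖softThrMode n α u - u‖ ^ 2) := by
  obtain ⟨σ, f, g, hu, hv⟩ := isSoftThr_softThrMode hα n u
  rw [hsv_eq hu, hsv_eq hv]
  exact hu.hasSum_softThr_sub_sq (isTensorPairing_tensorMul n) hα hv

theorem thrDist_eq_norm (hα : 0 < α) (n : Finset ι) (u : HilbertTensor H) :
    thrDist n α u = ‖softThrMode n α u - u‖ := by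
  unfold thrDist
  rw [(hasSum_hsv_softThrMode_sub_sq hα n u).tsum_eq, Real.sqrt_sq (norm_nonneg _)]

theorem hsv_nonneg (n : Finset ι) (u : HilbertTensor H) (k : ℕ) : 0 ≤ hsv n u k := by
  obtain ⟨f, g, h⟩ := exists_isTensorSVD_hsv n u
  exact h.nonneg k

theorem antitone_hsv (n : Finset ι) (u : HilbertTensor H) : Antitone (hsv n u) := by
  obtain ⟨f, g, h⟩ := exists_isTensorSVD_hsv n u
  exact h.antitone

theorem tendsto_hsv (n : Finset ι) (u : HilbertTensor H) :
    Filter.Tendsto (hsv n u) Filter.atTop (nhds 0) := by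
  obtain ⟨f, g, h⟩ := exists_isTensorSVD_hsv n u
  exact h.tendsto_zero (isTensorPairing_tensorMul n)

theorem summable_hsv_sq (n : Finset ι) (u : HilbertTensor H) :
    Summable fun k => hsv n u k ^ 2 := by
  obtain ⟨f, g, h⟩ := exists_isTensorSVD_hsv n u
  exact (h.hasSum_sq (isTensorPairing_tensorMul n)).summable

theorem bestApproxError_eq (n : Finset ι) (r : ℕ) (u : HilbertTensor H) :
    bestApproxError n r u = √(∑' k, hsv n u (r + k) ^ 2) := by
  obtain ⟨f, g, h⟩ := exists_isTensorSVD_hsv n u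
  have hB := isTensorPairing_tensorMul (H := H) n
  obtain ⟨w, hw, hwn⟩ := h.exists_truncation hB r
  unfold bestApproxError
  have : Nonempty {w : HilbertTensor H // hrank n w ≤ r} := ⟨⟨w, hw⟩⟩
  refine le_antisymm ?_ (le_ciInf fun z => ?_)
  · refine (ciInf_le ⟨0, ?_⟩ (⟨w, hw⟩ : {w : HilbertTensor H // hrank n w ≤ r})).trans_eq ?_
    · rintro _ ⟨z, rfl⟩
      exact norm_nonneg _
    · rw [← hwn, Real.sqrt_sq (norm_nonneg _)]
  · refine Real.sqrt_le_iff.2 ⟨norm_nonneg _, h.tsum_tail_le_norm_sub_sq hB z.2⟩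

theorem isGreatest_thrRank (n : Finset ι) {δ : ℝ} (hδ : 0 < δ) (u : HilbertTensor H) :
    IsGreatest (rankSet n δ u) (thrRank n δ u) :=
  isGreatest_sSup_threshold hδ (tendsto_hsv n u)

theorem thrDist_eq (hα : 0 < α) (n : Finset ι) (u : HilbertTensor H) :
    thrDist n α u = √(α ^ 2 * thrRank n α u + bestApproxError n (thrRank n α u) u ^ 2) := by
  have h1 := (hasSum_hsv_softThrMode_sub_sq hα n u).summable
  unfold thrDist
  simp only [hsv_softThrMode hα] at h1 ⊢
  rw [tsum_softThr_sub_sq hα (hsv_nonneg n u) (lt_iff_lt_of_isGreatest_threshold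
    (antitone_hsv n u) (isGreatest_thrRank n hα u)) h1, bestApproxError_eq, Real.sq_sqrt]
  exact tsum_nonneg fun _ => sq_nonneg _

/-! ### Successive soft thresholding -/

/-- Successive soft thresholding with respect to the members of a list. -/
def softThrList (l : List (Finset ι)) (α : ℝ) (u : HilbertTensor H) : HilbertTensor H :=
  l.foldl (fun v m => softThrMode m α v) u

theorem norm_softThrList_sub_le (hα : 0 < α) (l : List (Finset ι)) (u v : HilbertTensor H) :
    ‖softThrList l α u - softThrList l α v‖ ≤ ‖u - v‖ := by
  induction l generalizing u v with
  | nil => exact le_rfl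
  | cons m l ih =>
    exact (ih (softThrMode m α u) (softThrMode m α v)).trans
      ((isSoftThr_softThrMode hα m u).norm_sub_le (isTensorPairing_tensorMul m) hα
        (isSoftThr_softThrMode hα m v))

/-- Inserting `softThrList l α u` and using nonexpansiveness keeps every summand evaluated at `u`
rather than at an intermediate iterate. -/
theorem norm_softThrList_sub_self_le (hα : 0 < α) (l : List (Finset ι)) (u : HilbertTensor H) :
    ‖softThrList l α u - u‖ ≤ (l.map fun m => thrDist m α u).sum := by
  induction l with
  | nil => simp [softThrList]
  | cons m l ih =>
    rw [List.map_cons, List.sum_cons, thrDist_eq_norm hα]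
    have h1 := norm_softThrList_sub_le hα l (softThrMode m α u) u
    calc _ ≤ ‖softThrList l α (softThrMode m α u) - softThrList l α u‖
          + ‖softThrList l α u - u‖ := norm_sub_le_norm_sub_add_norm_sub _ _ _
      _ ≤ _ := add_le_add h1 ih

theorem hsv_softThrList_le (hα : 0 < α) (l : List (Finset ι)) (hl : ∀ n ∈ l, NonCrossing n m)
    (u : HilbertTensor H) (k : ℕ) : hsv m (softThrList l α u) k ≤ hsv m u k := by
  induction l generalizing u with
  | nil => exact le_rfl
  | cons n l ih =>
    exact (ih (fun n' hn' => hl n' (List.mem_cons_of_mem _ hn')) (softThrMode n α u)).trans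
      ((isSoftThr_softThrMode hα n u).hsv_le hα.le (hl n List.mem_cons_self) k)

/-- The list is split at `m`: the steps before and after it do not increase the singular values
along `m`, and `softThr` is monotone. -/
theorem hsv_softThrList_le_softThr (hα : 0 < α) (l : List (Finset ι))
    (hl : ∀ n ∈ l, NonCrossing n m) (hm : m ∈ l) (u : HilbertTensor H) (k : ℕ) :
    hsv m (softThrList l α u) k ≤ softThr α (hsv m u k) := by
  obtain ⟨l₁, l₂, rfl⟩ := List.append_of_mem hm
  have h1 : softThrList (l₁ ++ m :: l₂) α u
      = softThrList l₂ α (softThrMode m α (softThrList l₁ α u)) := by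
    simp [softThrList, List.foldl_append]
  rw [h1]
  refine (hsv_softThrList_le hα l₂ (fun n hn => hl n (by simp [hn])) _ k).trans ?_
  rw [hsv_softThrMode hα]
  exact softThr_mono hα.le (hsv_nonneg _ _ _)
    (hsv_softThrList_le hα l₁ (fun n hn => hl n (by simp [hn])) u k)

theorem thrDist_le_norm_softThrList_sub (hα : 0 < α) (l : List (Finset ι))
    (hl : ∀ n ∈ l, NonCrossing n m) (hm : m ∈ l) (u : HilbertTensor H) :
    thrDist m α u ≤ ‖softThrList l α u - u‖ := by
  set v := softThrList l α u with hv
  have hle : ∀ k, hsv m v k ≤ softThr α (hsv m u k) := hsv_softThrList_le_softThr hα l hl hm u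
  obtain ⟨f, g, hsu⟩ := exists_isTensorSVD_hsv m u
  obtain ⟨f', g', hsv'⟩ := exists_isTensorSVD_hsv m v
  obtain ⟨r, hr⟩ := exists_softThr_eq_zero hα (hsv_nonneg m u) (tendsto_hsv m u)
  -- Domination by the thresholded sequence also provides the finite rank that the trace argument
  -- requires.
  obtain ⟨h1, h2⟩ := hsu.hasSum_sub_sq_le (isTensorPairing_tensorMul m) hsv'
    ⟨r, le_antisymm ((hle r).trans_eq (hr r le_rfl)) (hsv_nonneg m v r)⟩
  refine Real.sqrt_le_iff.2 ⟨norm_nonneg _, le_trans ?_ h2⟩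
  refine (hasSum_hsv_softThrMode_sub_sq hα m u).summable.tsum_le_tsum (fun k => ?_) h1
  rw [hsv_softThrMode hα]
  have h3 := hle k
  have h4 := softThr_le_self hα.le (hsv_nonneg m u k)
  nlinarith

end Edges

/-! ### Edges of dimension trees -/

theorem IsDimTree.laminar {ι : Type*} [DecidableEq ι] {r : Finset ι} {T : Finset (Finset ι)}
    (h : IsDimTree r T) : (∀ a ∈ T, a ⊆ r) ∧
      ∀ a ∈ T, ∀ b ∈ T, a ⊆ b ∨ b ⊆ a ∨ Disjoint a b := by
  induction h with
  | leaf i => simp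
  | @node r₁ r₂ T₁ T₂ _ _ hd ih₁ ih₂ =>
    have hsub : ∀ a ∈ insert (r₁ ∪ r₂) (T₁ ∪ T₂), a ⊆ r₁ ∪ r₂ := by
      intro a ha
      rcases Finset.mem_insert.1 ha with rfl | ha
      · exact subset_rfl
      rcases Finset.mem_union.1 ha with ha | ha
      · exact (ih₁.1 a ha).trans Finset.subset_union_left
      · exact (ih₂.1 a ha).trans Finset.subset_union_right
    refine ⟨hsub, fun a ha b hb => ?_⟩
    rcases Finset.mem_insert.1 ha with rfl | ha'
    · exact Or.inr (Or.inl (hsub b hb))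
    rcases Finset.mem_insert.1 hb with rfl | hb'
    · exact Or.inl (hsub a ha)
    rcases Finset.mem_union.1 ha' with ha' | ha' <;> rcases Finset.mem_union.1 hb' with hb' | hb'
    · exact ih₁.2 a ha' b hb'
    · exact Or.inr (Or.inr (hd.mono (ih₁.1 a ha') (ih₂.1 b hb')))
    · exact Or.inr (Or.inr (hd.symm.mono (ih₂.1 a ha') (ih₁.1 b hb')))
    · exact ih₂.2 a ha' b hb'

/-- Edges are unordered, so the chosen side of an edge may be the complement of a node. -/
theorem exists_node_of_mem_edges {ι : Type*} [Fintype ι] [DecidableEq ι] {T : Finset (Finset ι)}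
    {n : Finset ι} (h : s(n, nᶜ) ∈ edges T) : ∃ a ∈ T, n = a ∨ n = aᶜ := by
  obtain ⟨a, ha, he⟩ := Finset.mem_image.1 h
  refine ⟨a, Finset.mem_of_mem_erase ha, ?_⟩
  rcases Sym2.eq_iff.1 he with ⟨h1, -⟩ | ⟨-, h2⟩
  · exact Or.inl h1.symm
  · exact Or.inr h2.symm

theorem nonCrossing_of_mem_edges {ι : Type*} [Fintype ι] [DecidableEq ι] {r : Finset ι}
    {T : Finset (Finset ι)} (hT : IsDimTree r T) {n m : Finset ι} (hn : s(n, nᶜ) ∈ edges T)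
    (hm : s(m, mᶜ) ∈ edges T) : NonCrossing n m := by
  obtain ⟨a, ha, hna⟩ := exists_node_of_mem_edges hn
  obtain ⟨b, hb, hmb⟩ := exists_node_of_mem_edges hm
  have h := hT.laminar.2 a ha b hb
  unfold NonCrossing
  simp only [Finset.disjoint_left, Finset.subset_iff] at h ⊢
  rcases hna with rfl | rfl <;> rcases hmb with rfl | rfl <;> rcases h with h | h | h <;>
    simp only [Finset.mem_compl, not_not] <;> grind

end HTensor

end

theorem lemma3p3 {d : ℕ} (hd : 2 ≤ d) (H : Fin d → Type*)
    [∀ i, NormedAddCommGroup (H i)] [∀ i, InnerProductSpace ℝ (H i)]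
    [∀ i, CompleteSpace (H i)] [∀ i, TopologicalSpace.SeparableSpace (H i)]
    (T : Finset (Finset (Fin d))) (hT : HTensor.IsDimTree Finset.univ T)
    (n : Fin (HTensor.edges T).card → Finset (Fin d)) (hn : HTensor.IsEdgeEnumeration T n)
    (u : HTensor.HilbertTensor H) :
    (∀ t, Summable (fun k => HTensor.hsv (n t) u k ^ 2)) ∧
    (∀ t (r : ℕ), HTensor.bestApproxError (n t) r u = √(∑' k, HTensor.hsv (n t) u (r + k) ^ 2)) ∧
    (∀ t (δ : ℝ), 0 < δ →
      IsGreatest (HTensor.rankSet (n t) δ u) (HTensor.thrRank (n t) δ u)) ∧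
    ∀ α : ℝ, 0 < α →
      ((∀ t, HTensor.thrDist (n t) α u ≤ ‖HTensor.softThrTensor n α u - u‖) ∧
        ‖HTensor.softThrTensor n α u - u‖ ≤ ∑ t, HTensor.thrDist (n t) α u) ∧
      ∀ t, Summable (fun k =>
          (HTensor.hsv (n t) (HTensor.softThrMode (n t) α u) k - HTensor.hsv (n t) u k) ^ 2) ∧
        HTensor.thrDist (n t) α u =
          √(α ^ 2 * HTensor.thrRank (n t) α u +
            HTensor.bestApproxError (n t) (HTensor.thrRank (n t) α u) u ^ 2) := by
  refine ⟨fun t => HTensor.summable_hsv_sq _ u, fun t r => HTensor.bestApproxError_eq _ r u,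
    fun t δ hδ => HTensor.isGreatest_thrRank _ hδ u, fun α hα => ⟨⟨fun t => ?_, ?_⟩, fun t =>
      ⟨(HTensor.hasSum_hsv_softThrMode_sub_sq hα _ u).summable, HTensor.thrDist_eq hα _ u⟩⟩⟩
  · have hmem : ∀ t, s(n t, (n t)ᶜ) ∈ HTensor.edges T := fun t => hn.mapsTo (Set.mem_univ t)
    refine HTensor.thrDist_le_norm_softThrList_sub hα (List.ofFn n) (fun m hm => ?_)
      ((List.mem_ofFn' _ _).2 ⟨t, rfl⟩) u
    obtain ⟨s, rfl⟩ := (List.mem_ofFn' _ _).1 hm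
    exact HTensor.nonCrossing_of_mem_edges hT (hmem s) (hmem t)
  · refine (HTensor.norm_softThrList_sub_self_le hα (List.ofFn n) u).trans_eq ?_
    rw [List.map_ofFn, List.sum_ofFn]
    rfl
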